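/- A phase field of mass $w\ge 0$ is an integrable, locally absolutely continuous function $\psi:\mathbb R\to\mathbb R$ with $\int_{\mathbb R}\psi\,dy=w$. A phase field cost $c:[0,\infty)\to[0,\infty)$ \emph{induces} $\tau:[0,\infty)\to[0,\infty)$ if for all $w\ge 0$ $$\tau(w)=\inf\Big\{\int_{\mathbb R}\tfrac12|\psi'(y)|^2+c(|\psi(y)|)\,dy\ \Big|\ \psi\text{ a phase field of mass }w\Big\}.$$ A function $\tau:[0,\infty)\to[0,\infty)$ is \emph{admissible} if it is nondecreasing, concave and continuous with $\tau(0)=0$, and it is \emph{piecewise affine} if there is a locally finite set of breakpoints such that $\tau$ is affine on every compact interval having no breakpoint in its interior. Let $I=\{1,\dots,N\}$ with $N\ge1$, or $I=\{1,2,\dots\}$. Let $0=\phi_0<\phi_1<\phi_2<\dots$, with $\phi_N=\infty$ if $I$ is finite, and let $\infty>a_1>a_2>\dots$ with $a_i\ge 0$ for all $i\in I$. The phase field cost $c$ with coefficients $(a_i,\phi_i)_{i\in I}$ is given by $c(0)=0$ and $z(\phi)=c(\phi)/\phi=a_i$ for $\phi\in[\phi_{i-1},\phi_i)$, $\phi>0$,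 $i\in I$; if $I$ is infinite and $\phi_\infty=\lim_i\phi_i<\infty$, we moreover set $z(\phi)=\lim_i a_i$ for $\phi\ge\phi_\infty$. \textbf{Theorem (Generalized urban planning).} (1) The phase field cost $c$ with coefficients $(a_i,\phi_i)_{i\in I}$ induces a (finite) cost $\tau$, namely $$\tau(w)=\inf\Big\{w a_j+\frac{4\sqrt2}{3}\sum_{i=1}^{j-1}\sqrt{a_i-a_j}\,\big(\phi_i^{3/2}-\phi_{i-1}^{3/2}\big)\ \Big|\ j\in I\Big\}\qquad(w\ge0).$$ If the intervals $[\phi_{i-1},\phi_i)$ exhaust $[0,\infty)$, that is, if $I$ is finite or $\phi_i\to\infty$, then $\tau$ is piecewise affine. (2) Conversely, let $\tau$ be admissible and piecewise affine. Then there are an index set $I$ as above, breakpoints $0=w_0<w_1<w_2<\dots$ (with $w_N=\infty$ if $I$ is finite and $w_i\to\infty$ if $I$ is infinite) and slopes $a_1>a_2>\dots\ge0$ such that $\tau$ is affine with slope $a_i$ on $[w_{i-1},w_i)$ for each $i\in I$. There is a sequence $0=\phi_0<\phi_1<\phi_2<\dots$ (with $\phi_N=\infty$ if $I$ is finite) which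 satisfies the recursion $$\phi_j^{3/2}-\phi_{j-1}^{3/2}=\Big(\frac{3w_j}{4\sqrt2}-\sum_{i=1}^{j-1}\frac{\phi_i^{3/2}-\phi_{i-1}^{3/2}}{\sqrt{a_i-a_{j+1}}+\sqrt{a_i-a_j}}\Big)\sqrt{a_j-a_{j+1}}\qquad(j,\,j+1\in I),$$ and the phase field cost $c$ with coefficients $(a_i,\phi_i)_{i\in I}$ induces $\tau$. -/

import Mathlib

open Set Filter Topology MeasureTheory

noncomputable section

/-- Phase fields of mass `w`: integrable, locally absolutely continuous functions on the line
(that is, the continuous representatives of integrable functions whose weak derivative is locally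
integrable) with integral `w`. -/
structure IsPhaseField (w : ℝ) (ψ : ℝ → ℝ) : Prop where
  absCont : ∀ x y : ℝ, AbsolutelyContinuousOnInterval ψ x y
  integrable : Integrable ψ
  mass : ∫ y, ψ y = w

/-- The phase field energy `F^c[ψ] = ∫ ½|ψ'|² + c(|ψ|)`, with values in `[0,∞]`. The derivative of
a locally absolutely continuous function exists almost everywhere and is its weak derivative. -/
def phaseFieldEnergy (c ψ : ℝ → ℝ) : ENNReal :=
  ∫⁻ y, ENNReal.ofReal (1 / 2 * |deriv ψ y| ^ 2 + c |ψ y|)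

/-- The phase field cost `c` induces the transport cost `τ` (functions of an argument in `[0,∞)`;
values at negative arguments are irrelevant). -/
def Induces (c τ : ℝ → ℝ) : Prop :=
  ∀ w : ℝ, 0 ≤ w →
    0 ≤ τ w ∧ ENNReal.ofReal (τ w) = ⨅ (ψ : ℝ → ℝ) (_ : IsPhaseField w ψ), phaseFieldEnergy c ψ

/-- Admissible transport costs on `[0,∞)`. -/
structure IsAdmissible (τ : ℝ → ℝ) : Prop where
  nonneg : ∀ w : ℝ, 0 ≤ w → 0 ≤ τ w
  monotone : MonotoneOn τ (Ici 0)
  concave : ConcaveOn ℝ (Ici 0) τ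
  continuous : ContinuousOn τ (Ici 0)
  zero : τ 0 = 0

/-- `τ` is piecewise affine on `[0,∞)`: there is a locally finite set of breakpoints such that `τ`
is affine on every compact interval without breakpoints in its interior. -/
def IsPiecewiseAffine (τ : ℝ → ℝ) : Prop :=
  ∃ S : Set ℝ, (∀ R : ℝ, (S ∩ Icc 0 R).Finite) ∧
    ∀ x y : ℝ, 0 ≤ x → x ≤ y → Disjoint (Ioo x y) S →
      ∃ m b : ℝ, ∀ t ∈ Icc x y, τ t = m * t + b

/-- The index set `I = {1, …, N}`, respectively `I = {1, 2, …}` if `N = ⊤`. -/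
def pieceIndices (N : ℕ∞) : Set ℕ := {i | 1 ≤ i ∧ (i : ℕ∞) ≤ N}

/-- The interval `[p_{i-1}, p_i)`, where `p_N = ∞` if `N` is finite. -/
def piece (N : ℕ∞) (p : ℕ → ℝ) (i : ℕ) : Set ℝ :=
  {x | p (i - 1) ≤ x ∧ ((i : ℕ∞) < N → x < p i)}

/-- `0 = p_0 < p_1 < p_2 < …`; only the values `p i` with `i < N` matter, and `p_N = ∞` if `N` is
finite. -/
structure IsPartition (N : ℕ∞) (p : ℕ → ℝ) : Prop where
  zero : p 0 = 0
  strictMono : StrictMonoOn p {i : ℕ | (i : ℕ∞) < N}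

/-- Coefficients of a nonincreasing piecewise constant function: `0 = φ_0 < φ_1 < …` and
`∞ > a_1 > a_2 > … ≥ 0`, with index set `{1, …, N}` or `{1, 2, …}`. -/
structure IsStepData (N : ℕ∞) (a φ : ℕ → ℝ) : Prop where
  nonempty : 1 ≤ N
  partition : IsPartition N φ
  strictAnti : StrictAntiOn a (pieceIndices N)
  nonneg : ∀ i ∈ pieceIndices N, 0 ≤ a i

/-- The mass-specific phase field cost `z(φ) = c(φ)/φ`. -/
def massSpecificCost (c : ℝ → ℝ) (x : ℝ) : ℝ := c x / x

/-- `c` is the phase field cost with `c(0) = 0` whose mass-specific cost equals `a_i` on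
`[φ_{i-1}, φ_i)`. If there are infinitely many pieces which do not exhaust `[0,∞)`, the
mass-specific cost is continued beyond all `φ_i` by the limit of the decreasing sequence `a_i`. -/
structure IsStepCost (N : ℕ∞) (a φ : ℕ → ℝ) (c : ℝ → ℝ) : Prop where
  zero : c 0 = 0
  step : ∀ i ∈ pieceIndices N, ∀ x ∈ piece N φ i, 0 < x → massSpecificCost c x = a i
  tail : N = ⊤ → ∀ x : ℝ, (∀ i : ℕ, φ i ≤ x) → massSpecificCost c x = ⨅ i : ℕ, a (i + 1)

/-- The affine function
`w ↦ w a_j + (4√2/3) ∑_{i=1}^{j-1} √(a_i - a_j) (φ_i^{3/2} - φ_{i-1}^{3/2})`. -/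
def affineCost (a φ : ℕ → ℝ) (j : ℕ) (w : ℝ) : ℝ :=
  w * a j + 4 * √2 / 3 *
    ∑ i ∈ Finset.Ico 1 j, √(a i - a j) * (φ i ^ (3 / 2 : ℝ) - φ (i - 1) ^ (3 / 2 : ℝ))

/-- `τ` has the breakpoints `0 = w_0 < w_1 < w_2 < …` (exhausting `[0,∞)`) and the strictly
decreasing slopes `a_i` on `[w_{i-1}, w_i)`, `i ∈ I`. -/
structure HasSlopes (N : ℕ∞) (a w : ℕ → ℝ) (τ : ℝ → ℝ) : Prop where
  nonempty : 1 ≤ N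
  partition : IsPartition N w
  exhaust : N = ⊤ → Tendsto w atTop atTop
  strictAnti : StrictAntiOn a (pieceIndices N)
  affine : ∀ i ∈ pieceIndices N, ∀ x ∈ piece N w i, τ x = τ (w (i - 1)) + a i * (x - w (i - 1))

/-- The recursion
`φ_j^{3/2} - φ_{j-1}^{3/2} = (3 w_j/(4√2) - ∑_{i=1}^{j-1} (φ_i^{3/2} - φ_{i-1}^{3/2}) /
  (√(a_i - a_{j+1}) + √(a_i - a_j))) √(a_j - a_{j+1})`
for all `j ≥ 1` such that `j + 1` is an index. -/
def SatisfiesRecursion (N : ℕ∞) (a w φ : ℕ → ℝ) : Prop :=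
  ∀ j : ℕ, 1 ≤ j → (j : ℕ∞) < N →
    φ j ^ (3 / 2 : ℝ) - φ (j - 1) ^ (3 / 2 : ℝ) =
      (3 * w j / (4 * √2) -
        ∑ i ∈ Finset.Ico 1 j, (φ i ^ (3 / 2 : ℝ) - φ (i - 1) ^ (3 / 2 : ℝ)) /
          (√(a i - a (j + 1)) + √(a i - a j))) * √(a j - a (j + 1))

end

/-!
The affine functions `ℓ_j(w) = w a_j + (4√2/3) ∑_{i<j} √(a_i - a_j) (φ_i^{3/2} - φ_{i-1}^{3/2})`
(`affineCost`) arise as follows.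

**Lower bound.** Suppose that `c(|ψ|) ≥ l |ψ|` along a phase field `ψ` of mass `w`. Charging the
mass with the price `l` leaves `∫ ½|ψ'|² + c(|ψ|) - l|ψ|`. On the level set
`φ_{i-1} < |ψ| < φ_i` the integrand is at least `√(2(a_i - l)|ψ|) |ψ'|`, a multiple of
`|(|ψ|^{3/2})'|` (Modica–Mortola). If `ψ` reaches the height `φ_{J-1}`, then for all `i < J` this
level set is crossed on both sides of the point where it does, and the fundamental theorem of
calculus for absolutely continuous functions gives `energy_lower_bound`. The choice `l = a_j` is
admissible if `|ψ| < φ_j` everywhere; for the first such `j` the bound reads `ℓ_j(w)`. If there is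
no such `j` among finitely many indices, take `l = a_N`; among infinitely many, `l = lim a_i` gives
the bound `ℓ_J(w)` up to an arbitrarily small error for `J` large
(`IsStepCost.exists_affineCost_le`).

**Upper bound.** Equality in Modica–Mortola means that `u = √ψ` is affine with slope `k_i/2`,
`k_i = √(2(a_i - a_{j+1}))`, between the heights `√φ_{i-1}` and `√φ_i`. Two such flanks rising to
`φ_j`, joined by a plateau at that height, where the mass costs `a_{j+1}` per unit, have energy
`ℓ_{j+1}(w)`, provided `w` is at least the mass of the flanks. This is the case if `w` is at least
the mass `W_j` (`crossingMass`) at which `ℓ_j` and `ℓ_{j+1}` cross; if `w ≤ W_j`, then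
`ℓ_j(w) ≤ ℓ_{j+1}(w)`, and induction on `j` applies (`IsStepCost.iInf_energy_le`). For `j = 1` low
and wide phase fields do. Hence `c` induces `inf_j ℓ_j` (`IsStepCost.induces`).

**Piecewise affinity.** The crossing masses `W_j` tend to infinity if the `φ_j` do, so that only
finitely many `ℓ_j` compete on a bounded set (`IsStepData.isPiecewiseAffine`).

**Converse.** A piecewise affine admissible `τ` is decomposed into its maximal affine pieces
(`exists_hasSlopes`). The recursion says precisely that `W_j = w_j`; its solution has positive
increments because the denominators grow with `j` while `w_{j-1} < w_j` (`HasSlopes.levelIncrement_pos`). Then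
`τ = ℓ_j` on the `j`-th piece, `τ = inf_j ℓ_j`, and the first part applies (`HasSlopes.isGLB`).
-/

/-! ### Lower bound for the energy -/

theorem AbsolutelyContinuousOnInterval.comp_lipschitzOnWith {f g : ℝ → ℝ} {s : Set ℝ} {K : NNReal}
    {x y : ℝ} (hf : AbsolutelyContinuousOnInterval f x y) (hg : LipschitzOnWith K g s)
    (hs : MapsTo f (uIcc x y) s) : AbsolutelyContinuousOnInterval (fun t ↦ g (f t)) x y := by
  rw [absolutelyContinuousOnInterval_iff] at hf ⊢
  intro ε hε
  obtain ⟨δ, hδ, h⟩ := hf (ε / (K + 1)) (by positivity)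
  refine ⟨δ, hδ, fun E hE hlen ↦ ?_⟩
  have h1 := h E hE hlen
  calc ∑ i ∈ Finset.range E.1, dist (g (f (E.2 i).1)) (g (f (E.2 i).2))
      ≤ ∑ i ∈ Finset.range E.1, K * dist (f (E.2 i).1) (f (E.2 i).2) := by
        refine Finset.sum_le_sum fun i hi ↦ ?_
        obtain ⟨h2, h3⟩ := hE.1 i hi
        exact hg.dist_le_mul _ (hs h2) _ (hs h3)
    _ = K * ∑ i ∈ Finset.range E.1, dist (f (E.2 i).1) (f (E.2 i).2) := by rw [Finset.mul_sum]
    _ ≤ K * (ε / (K + 1)) := by gcongr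
    _ < ε := by
        rw [mul_div_assoc', div_lt_iff₀ (by positivity)]
        nlinarith [K.2]

theorem AbsolutelyContinuousOnInterval.abs_rpow {f : ℝ → ℝ} {x y p : ℝ}
    (hf : AbsolutelyContinuousOnInterval f x y) (hp : 1 < p) :
    AbsolutelyContinuousOnInterval (fun t ↦ |f t| ^ p) x y := by
  obtain ⟨C, hC⟩ := hf.exists_bound
  have h1 : ContDiffOn ℝ 1 (fun t : ℝ ↦ |t| ^ p) (Icc (-C) C) :=
    (contDiff_norm_rpow (E := ℝ) hp).contDiffOn
  obtain ⟨K, hK⟩ := h1.exists_lipschitzOnWith one_ne_zero (convex_Icc _ _) isCompact_Icc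
  have hmaps : MapsTo f (uIcc x y) (Icc (-C) C) := fun t ht ↦ abs_le.1 (hC t ht)
  exact hf.comp_lipschitzOnWith (g := fun t : ℝ ↦ |t| ^ p) hK hmaps

/-- A continuous function which is at most `p` at `x` and at least `q > p` at `y` has a crossing
interval between `x` and `y`, on which it takes values strictly between `p` and `q`. -/
theorem exists_crossing {f : ℝ → ℝ} (hf : Continuous f) {x y p q : ℝ} (hxy : x ≤ y) (hpq : p < q)
    (hx : f x ≤ p) (hy : q ≤ f y) :
    ∃ α β, x ≤ α ∧ α < β ∧ β ≤ y ∧ f α = p ∧ f β = q ∧ ∀ t ∈ Ioo α β, f t ∈ Ioo p q := by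
  -- `β` is the first point at or above the level `q`, `α` the last one before it at or below `p`.
  have hB : IsCompact (Icc x y ∩ f ⁻¹' Ici q) :=
    isCompact_Icc.inter_right (isClosed_Ici.preimage hf)
  obtain ⟨β, ⟨⟨hβ1, hβ2⟩, hβ3⟩, hβ4⟩ := hB.exists_isLeast ⟨y, ⟨hxy, le_rfl⟩, hy⟩
  have hA : IsCompact (Icc x β ∩ f ⁻¹' Iic p) :=
    isCompact_Icc.inter_right (isClosed_Iic.preimage hf)
  obtain ⟨α, ⟨⟨hα1, hα2⟩, hα3⟩, hα4⟩ := hA.exists_isGreatest ⟨x, ⟨le_rfl, hβ1⟩, hx⟩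
  simp only [mem_preimage, mem_Ici, mem_Iic] at hβ3 hα3
  have hαβ : α < β := lt_of_le_of_ne hα2 (by rintro rfl; linarith)
  have hin : ∀ t ∈ Ioo α β, f t ∈ Ioo p q := by
    refine fun t ht ↦ ⟨not_le.1 fun h ↦ ?_, not_le.1 fun h ↦ ?_⟩
    · exact absurd (hα4 ⟨⟨hα1.trans ht.1.le, ht.2.le⟩, h⟩) (not_le.2 ht.1)
    · exact absurd (hβ4 ⟨⟨hα1.trans ht.1.le, ht.2.le.trans hβ2⟩, h⟩) (not_le.2 ht.2)
  have hcl : ∀ t ∈ Icc α β, f t ∈ Icc p q := by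
    have := MapsTo.closure (s := Ioo α β) (t := Ioo p q) hin hf
    rw [closure_Ioo hαβ.ne, closure_Ioo hpq.ne] at this
    exact this
  exact ⟨α, β, hα1, hαβ, hβ2, le_antisymm hα3 (hcl α ⟨le_rfl, hαβ.le⟩).1,
    le_antisymm (hcl β ⟨hαβ.le, le_rfl⟩).2 hβ3, hin⟩

theorem exists_crossing_of_ge {f : ℝ → ℝ} (hf : Continuous f) {x y p q : ℝ} (hxy : x ≤ y)
    (hpq : p < q) (hx : q ≤ f x) (hy : f y ≤ p) :
    ∃ α β, x ≤ α ∧ α < β ∧ β ≤ y ∧ f α = q ∧ f β = p ∧ ∀ t ∈ Ioo α β, f t ∈ Ioo p q := by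
  obtain ⟨α, β, h1, h2, h3, h4, h5, h6⟩ := exists_crossing (f := fun t ↦ f (-t)) (by fun_prop)
    (neg_le_neg hxy) hpq (by simpa using hy) (by simpa using hx)
  refine ⟨-β, -α, by linarith, by linarith, by linarith, h5, h4, fun t ht ↦ ?_⟩
  simpa using h6 (-t) ⟨by linarith [ht.2], by linarith [ht.1]⟩

/-- The Modica–Mortola inequality on an interval where `|ψ|` crosses from one level to another:
`½ψ'² + ½k²|ψ| ≥ k√|ψ||ψ'| = ⅔k|(|ψ|^{3/2})'|`. -/
theorem crossing_energy_le {ψ d : ℝ → ℝ} {α β k : ℝ} (hαβ : α < β) (hk : 0 ≤ k)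
    (hψ : AbsolutelyContinuousOnInterval ψ α β)
    (hd : ∀ t ∈ Ioo α β, 1 / 2 * |deriv ψ t| ^ 2 + k ^ 2 / 2 * |ψ t| ≤ d t) :
    ENNReal.ofReal (2 / 3 * k * |(|ψ β| ^ (3 / 2 : ℝ) - |ψ α| ^ (3 / 2 : ℝ))|) ≤
      ∫⁻ t in Ioo α β, ENNReal.ofReal (d t) := by
  have hh := hψ.abs_rpow (p := 3 / 2) (by norm_num)
  have key := hh.integral_deriv_eq_sub
  rw [intervalIntegral.integral_of_le hαβ.le, ← restrict_Ioo_eq_restrict_Ioc] at key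
  rw [← key, ← abs_of_nonneg (show 0 ≤ 2 / 3 * k by positivity), ← abs_mul,
    ← integral_const_mul, ← Real.enorm_eq_ofReal_abs]
  refine (enorm_integral_le_lintegral_enorm _).trans ?_
  refine lintegral_mono_ae ?_
  have hdiff := hψ.ae_differentiableAt
  filter_upwards [ae_restrict_of_ae hdiff, ae_restrict_mem measurableSet_Ioo] with t h1 h2
  have h3 := h1 (by rw [uIcc_of_le hαβ.le]; exact Ioo_subset_Icc_self h2)
  have h4 := ((hasDerivAt_abs_rpow (ψ t) (p := 3 / 2) (by norm_num)).comp t h3.hasDerivAt).deriv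
  rw [Real.enorm_eq_ofReal_abs]
  refine ENNReal.ofReal_le_ofReal (le_trans ?_ (hd t h2))
  have h5 : deriv (fun t ↦ |ψ t| ^ (3 / 2 : ℝ)) t =
      3 / 2 * |ψ t| ^ (3 / 2 - 2 : ℝ) * ψ t * deriv ψ t := h4
  rw [h5]
  have h6 : |ψ t| ^ (3 / 2 - 2 : ℝ) * |ψ t| = √|ψ t| := by
    rcases eq_or_ne (ψ t) 0 with h0 | h0
    · simp [h0]
    · rw [Real.sqrt_eq_rpow, ← Real.rpow_add_one (abs_ne_zero.2 h0)]
      norm_num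
  have h7 : |2 / 3 * k * (3 / 2 * |ψ t| ^ (3 / 2 - 2 : ℝ) * ψ t * deriv ψ t)| =
      k * (√|ψ t| * |deriv ψ t|) := by
    rw [← h6]
    simp only [abs_mul, abs_of_nonneg hk, abs_of_nonneg (Real.rpow_nonneg (abs_nonneg (ψ t)) _)]
    norm_num
    ring
  rw [h7]
  nlinarith [sq_nonneg (k * √|ψ t| - |deriv ψ t|), Real.sq_sqrt (abs_nonneg (ψ t))]

theorem IsPhaseField.continuous {w : ℝ} {ψ : ℝ → ℝ} (h : IsPhaseField w ψ) : Continuous ψ := by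
  rw [continuous_iff_continuousAt]
  intro x
  have := (h.absCont (x - 1) (x + 1)).continuousOn
  rw [uIcc_of_le (by linarith)] at this
  exact this.continuousAt (Icc_mem_nhds (by linarith) (by linarith))

theorem MeasureTheory.Integrable.exists_mem_abs_le {ψ : ℝ → ℝ} (h : Integrable ψ) {s : Set ℝ}
    (hs : volume s = ⊤) {p : ℝ} (hp : 0 < p) : ∃ y ∈ s, |ψ y| ≤ p := by
  by_contra! hcon
  refine (h.measure_norm_gt_lt_top hp).ne (top_unique ?_)
  rw [← hs]
  exact measure_mono fun y hy ↦ hcon y hy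

/-- The part of the energy spent on raising `|ψ|` from the level `p` to the level `q`, on either
side of a point where `|ψ|` is at least `q`. -/
theorem level_energy_le {w : ℝ} {ψ d : ℝ → ℝ} (hψ : IsPhaseField w ψ) {p q k x₀ : ℝ} (hp : 0 ≤ p)
    (hpq : p < q) (hk : 0 ≤ k) (hx₀ : q ≤ |ψ x₀|)
    (hd : ∀ t, |ψ t| ∈ Ioo p q → 1 / 2 * |deriv ψ t| ^ 2 + k ^ 2 / 2 * |ψ t| ≤ d t) :
    ENNReal.ofReal (4 / 3 * k * (q ^ (3 / 2 : ℝ) - p ^ (3 / 2 : ℝ))) ≤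
      ∫⁻ t in {t | |ψ t| ∈ Ioo p q}, ENNReal.ofReal (d t) := by
  have hc : Continuous fun t ↦ |ψ t| := hψ.continuous.abs
  -- It suffices to start from levels `p' > p`, which `|ψ|` falls below on both sides.
  have main : ∀ p' ∈ Ioo p q, ENNReal.ofReal (4 / 3 * k * (q ^ (3 / 2 : ℝ) - p' ^ (3 / 2 : ℝ))) ≤
      ∫⁻ t in {t | |ψ t| ∈ Ioo p q}, ENNReal.ofReal (d t) := by
    rintro p' ⟨hp1, hp2⟩
    have hp' : 0 < p' := hp.trans_lt hp1
    obtain ⟨y, hy, hy'⟩ := hψ.integrable.exists_mem_abs_le (Real.volume_Iio (a := x₀)) hp'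
    obtain ⟨z, hz, hz'⟩ := hψ.integrable.exists_mem_abs_le (Real.volume_Ioi (a := x₀)) hp'
    obtain ⟨α, β, h1, h2, h3, h4, h5, h6⟩ := exists_crossing hc (le_of_lt hy) hp2 hy' hx₀
    obtain ⟨γ, δ, g1, g2, g3, g4, g5, g6⟩ := exists_crossing_of_ge hc (le_of_lt hz) hp2 hx₀ hz'
    have hmono : p' ^ (3 / 2 : ℝ) ≤ q ^ (3 / 2 : ℝ) :=
      Real.rpow_le_rpow hp'.le hp2.le (by norm_num)
    have e1 := crossing_energy_le (d := d) h2 hk (hψ.absCont α β)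
      fun t ht ↦ hd t ⟨hp1.trans (h6 t ht).1, (h6 t ht).2⟩
    have e2 := crossing_energy_le (d := d) g2 hk (hψ.absCont γ δ)
      fun t ht ↦ hd t ⟨hp1.trans (g6 t ht).1, (g6 t ht).2⟩
    rw [h4, h5, abs_of_nonneg (sub_nonneg.2 hmono)] at e1
    rw [g4, g5, abs_sub_comm, abs_of_nonneg (sub_nonneg.2 hmono)] at e2
    have hdisj : Disjoint (Ioo α β) (Ioo γ δ) := by
      rw [Set.disjoint_left]
      exact fun t ht ht' ↦ absurd (ht.2.trans_le h3) (not_lt.2 (g1.trans ht'.1.le))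
    calc ENNReal.ofReal (4 / 3 * k * (q ^ (3 / 2 : ℝ) - p' ^ (3 / 2 : ℝ)))
        = ENNReal.ofReal (2 / 3 * k * (q ^ (3 / 2 : ℝ) - p' ^ (3 / 2 : ℝ))) +
          ENNReal.ofReal (2 / 3 * k * (q ^ (3 / 2 : ℝ) - p' ^ (3 / 2 : ℝ))) := by
          rw [← ENNReal.ofReal_add] <;> [ring_nf; skip; skip] <;>
            exact mul_nonneg (by positivity) (sub_nonneg.2 hmono)
      _ ≤ _ := add_le_add e1 e2
      _ = ∫⁻ t in Ioo α β ∪ Ioo γ δ, ENNReal.ofReal (d t) :=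
          (lintegral_union measurableSet_Ioo hdisj).symm
      _ ≤ _ := by
          refine lintegral_mono_set (union_subset (fun t ht ↦ ?_) fun t ht ↦ ?_)
          · exact ⟨hp1.trans (h6 t ht).1, (h6 t ht).2⟩
          · exact ⟨hp1.trans (g6 t ht).1, (g6 t ht).2⟩
  have hlim : Tendsto (fun p' : ℝ ↦
      ENNReal.ofReal (4 / 3 * k * (q ^ (3 / 2 : ℝ) - p' ^ (3 / 2 : ℝ)))) (𝓝[>] p)
      (𝓝 (ENNReal.ofReal (4 / 3 * k * (q ^ (3 / 2 : ℝ) - p ^ (3 / 2 : ℝ))))) := by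
    refine (ENNReal.continuous_ofReal.tendsto _).comp (tendsto_nhdsWithin_of_tendsto_nhds ?_)
    have : Continuous fun p' : ℝ ↦ 4 / 3 * k * (q ^ (3 / 2 : ℝ) - p' ^ (3 / 2 : ℝ)) :=
      continuous_const.mul (continuous_const.sub
        (Real.continuous_rpow_const (by norm_num)))
    exact this.tendsto p
  refine le_of_tendsto hlim ?_
  filter_upwards [Ioo_mem_nhdsGT hpq] with p' hp' using main p' hp'

/-- Lower bound for the energy of a phase field reaching the height `φ_{J-1}`, if the slope `l` is
a lower bound for the mass-specific cost along the phase field: the mass is charged with `l`, the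
excess is estimated level by level. -/
theorem energy_lower_bound {w l : ℝ} {ψ c : ℝ → ℝ} {a φ : ℕ → ℝ} {J : ℕ} (hψ : IsPhaseField w ψ)
    (hl : 0 ≤ l) (hφ0 : 0 ≤ φ 0) (hφ : ∀ i, 1 ≤ i → i < J → φ (i - 1) < φ i)
    (ha : ∀ i, 1 ≤ i → i < J → l ≤ a i)
    (hc : ∀ i, 1 ≤ i → i < J → ∀ s ∈ Ioo (φ (i - 1)) (φ i), c s = a i * s)
    (hlow : ∀ t, l * |ψ t| ≤ c |ψ t|) (hJ : 1 < J → ∃ x₀, φ (J - 1) ≤ |ψ x₀|) :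
    ENNReal.ofReal (w * l + 4 * √2 / 3 *
      ∑ i ∈ Finset.Ico 1 J, √(a i - l) * (φ i ^ (3 / 2 : ℝ) - φ (i - 1) ^ (3 / 2 : ℝ))) ≤
      phaseFieldEnergy c ψ := by
  have hmono : ∀ i j, i ≤ j → j < J → φ i ≤ φ j := by
    intro i j hij
    induction j, hij using Nat.le_induction with
    | base => exact fun _ ↦ le_rfl
    | succ j hij ih =>
      exact fun hj ↦ (ih (by omega)).trans (hφ (j + 1) (by omega) hj).le
  have hnn : ∀ i, i < J → 0 ≤ φ i := fun i hi ↦ hφ0.trans (hmono 0 i (Nat.zero_le _) hi)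
  set d : ℝ → ℝ := fun t ↦ 1 / 2 * |deriv ψ t| ^ 2 + c |ψ t| - l * |ψ t| with hd
  have hterm : ∀ i ∈ Finset.Ico 1 J,
      0 ≤ 4 / 3 * √(2 * (a i - l)) * (φ i ^ (3 / 2 : ℝ) - φ (i - 1) ^ (3 / 2 : ℝ)) := by
    intro i hi
    obtain ⟨h1, h2⟩ := Finset.mem_Ico.1 hi
    have := Real.rpow_le_rpow (hnn (i - 1) (by omega)) (hφ i h1 h2).le
      (show (0 : ℝ) ≤ 3 / 2 by norm_num)
    exact mul_nonneg (by positivity) (sub_nonneg.2 this)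
  -- The level sets belonging to different indices are disjoint.
  have hexc : ENNReal.ofReal (∑ i ∈ Finset.Ico 1 J,
      4 / 3 * √(2 * (a i - l)) * (φ i ^ (3 / 2 : ℝ) - φ (i - 1) ^ (3 / 2 : ℝ))) ≤
      ∫⁻ t, ENNReal.ofReal (d t) := by
    rw [ENNReal.ofReal_sum_of_nonneg hterm]
    have hdisj : Set.PairwiseDisjoint (↑(Finset.Ico 1 J))
        fun i ↦ {t | |ψ t| ∈ Ioo (φ (i - 1)) (φ i)} := by
      have aux : ∀ i j, i < j → j < J → ∀ t, |ψ t| < φ i → ¬ φ (j - 1) < |ψ t| :=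
        fun i j hij hj t h1 h2 ↦ absurd (hmono i (j - 1) (by omega) (by omega)) (by linarith)
      intro i hi j hj hij
      simp only [Finset.coe_Ico, mem_Ico] at hi hj
      refine Set.disjoint_left.2 fun t ht ht' ↦ ?_
      rcases lt_or_gt_of_ne hij with h | h
      · exact aux i j h hj.2 t ht.2 ht'.1
      · exact aux j i h hi.2 t ht'.2 ht.1
    calc _ ≤ ∑ i ∈ Finset.Ico 1 J,
          ∫⁻ t in {t | |ψ t| ∈ Ioo (φ (i - 1)) (φ i)}, ENNReal.ofReal (d t) := by
          refine Finset.sum_le_sum fun i hi ↦ ?_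
          obtain ⟨h1, h2⟩ := Finset.mem_Ico.1 hi
          obtain ⟨x₀, hx₀⟩ := hJ (by omega)
          refine level_energy_le hψ (hnn _ (by omega)) (hφ i h1 h2) (Real.sqrt_nonneg _)
            ((hmono i (J - 1) (by omega) (by omega)).trans hx₀) fun t ht ↦ le_of_eq ?_
          rw [hd, Real.sq_sqrt (by linarith [ha i h1 h2])]
          simp only [hc i h1 h2 _ ht]
          ring
      _ = ∫⁻ t in ⋃ i ∈ Finset.Ico 1 J, {t | |ψ t| ∈ Ioo (φ (i - 1)) (φ i)},
          ENNReal.ofReal (d t) := by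
          refine (lintegral_biUnion_finset hdisj (fun i _ ↦ ?_) _).symm
          exact (isOpen_Ioo.preimage hψ.continuous.abs).measurableSet
      _ ≤ _ := setLIntegral_le_lintegral _ _
  have hmass : ENNReal.ofReal (w * l) ≤ ∫⁻ t, ENNReal.ofReal (l * |ψ t|) := by
    rw [← ofReal_integral_eq_lintegral_ofReal (hψ.integrable.abs.const_mul l)
      (Eventually.of_forall fun t ↦ by positivity), integral_const_mul, mul_comm w]
    refine ENNReal.ofReal_le_ofReal (mul_le_mul_of_nonneg_left ?_ hl)
    rw [← hψ.mass]
    exact integral_mono hψ.integrable hψ.integrable.abs fun t ↦ le_abs_self _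
  have hsplit : phaseFieldEnergy c ψ =
      (∫⁻ t, ENNReal.ofReal (d t)) + ∫⁻ t, ENNReal.ofReal (l * |ψ t|) := by
    have hmeas : Measurable fun t ↦ ENNReal.ofReal (l * |ψ t|) :=
      ENNReal.measurable_ofReal.comp (hψ.continuous.abs.measurable.const_mul l)
    rw [← lintegral_add_right _ hmeas]
    refine lintegral_congr fun t ↦ ?_
    rw [← ENNReal.ofReal_add _ (by positivity), hd]
    · simp
    · have := hlow t
      simp only [hd]
      nlinarith [sq_nonneg |deriv ψ t|]
  rw [hsplit, add_comm (w * l)]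
  refine ENNReal.ofReal_add_le.trans (add_le_add (le_trans (le_of_eq ?_) hexc) hmass)
  rw [Finset.mul_sum]
  congr 1
  refine Finset.sum_congr rfl fun i _ ↦ ?_
  rw [Real.sqrt_mul (by norm_num)]
  ring

/-! ### Construction of phase fields from flanks and plateaus -/

/-- The energy density of the phase field `u²` at a point where `u` is differentiable. -/
noncomputable def sqEnergyDensity (c u : ℝ → ℝ) (t : ℝ) : ENNReal :=
  ENNReal.ofReal (1 / 2 * (2 * u t * deriv u t) ^ 2 + c (u t ^ 2))

/-- `u` is the square root of the left flank of a phase field: it vanishes on `(-∞, 0]`, equals the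
plateau value `R` on `[T, ∞)`, and on `[0, T]` the phase field `u²` has mass `M` and energy `E`. -/
structure IsRise (c u : ℝ → ℝ) (T R M E : ℝ) : Prop where
  length_nonneg : 0 ≤ T
  energy_nonneg : 0 ≤ E
  lipschitz : ∃ K, LipschitzWith K u
  eq_zero : ∀ t ≤ 0, u t = 0
  eq_plateau : ∀ t, T ≤ t → u t = R
  mass : ∫ t in (0 : ℝ)..T, u t ^ 2 = M
  energy : ∫⁻ t in Ioo 0 T, sqEnergyDensity c u t = ENNReal.ofReal E

theorem isRise_zero (c : ℝ → ℝ) : IsRise c (fun _ ↦ 0) 0 0 0 0 where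
  length_nonneg := le_rfl
  energy_nonneg := le_rfl
  lipschitz := ⟨0, LipschitzWith.const 0⟩
  eq_zero _ _ := rfl
  eq_plateau _ _ := rfl
  mass := by simp
  energy := by simp

theorem integral_affine_sq {k r r' T T' : ℝ} (hk : 0 < k) (hT' : T' = T + 2 * (r' - r) / k) :
    ∫ t in T..T', (r + k / 2 * (t - T)) ^ 2 = 2 / 3 * (r' ^ 3 - r ^ 3) / k := by
  have hderiv : ∀ t ∈ uIcc T T', HasDerivAt (fun t ↦ 2 / (3 * k) * (r + k / 2 * (t - T)) ^ 3)
      ((r + k / 2 * (t - T)) ^ 2) t := by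
    intro t _
    have h1 : HasDerivAt (fun t ↦ r + k / 2 * (t - T)) (k / 2) t := by
      simpa using (((hasDerivAt_id t).sub_const T).const_mul (k / 2)).const_add r
    refine ((h1.fun_pow 3).const_mul (2 / (3 * k))).congr_deriv ?_
    field_simp
    norm_num
    ring
  rw [intervalIntegral.integral_eq_sub_of_hasDerivAt hderiv
    ((by fun_prop : Continuous fun t ↦ (r + k / 2 * (t - T)) ^ 2).intervalIntegrable _ _)]
  have : r + k / 2 * (T' - T) = r' := by rw [hT']; field_simp; ring
  rw [this]
  field_simp
  ring

theorem setLIntegral_Ioo_union {f : ℝ → ENNReal} {x y z : ℝ} (hxy : x ≤ y) (hyz : y ≤ z) :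
    ∫⁻ t in Ioo x z, f t = (∫⁻ t in Ioo x y, f t) + ∫⁻ t in Ioo y z, f t := by
  rw [restrict_Ioo_eq_restrict_Ioc, restrict_Ioo_eq_restrict_Ioc, restrict_Ioo_eq_restrict_Ioc,
    ← Ioc_union_Ioc_eq_Ioc hxy hyz, lintegral_union measurableSet_Ioc]
  exact Set.disjoint_left.2 fun t ht ht' ↦ absurd ht.2 (not_le.2 ht'.1)

/-- A flank can be prolonged by a piece on which `u` is affine with slope `k/2`. -/
theorem IsRise.extend {c u : ℝ → ℝ} {T R M E : ℝ} (h : IsRise c u T R M E) {k a R' : ℝ}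
    (hk : 0 < k) (ha : 0 ≤ a) (hR : 0 ≤ R) (hR' : R < R')
    (hc : ∀ s ∈ Ioo R R', c (s ^ 2) = a * s ^ 2) :
    ∃ u' T', IsRise c u' T' R' (M + 2 / 3 * (R' ^ 3 - R ^ 3) / k)
      (E + (k ^ 2 / 2 + a) * (2 / 3 * (R' ^ 3 - R ^ 3) / k)) := by
  set T' := T + 2 * (R' - R) / k with hT'
  have hkT : k / 2 * (T' - T) = R' - R := by rw [hT']; field_simp; ring
  have hTT' : T < T' := by
    have : 0 < 2 * (R' - R) / k := div_pos (by linarith) hk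
    linarith
  set v : ℝ → ℝ := fun t ↦ u t + max 0 (min (k / 2 * (t - T)) (R' - R)) with hv
  have hleft : ∀ t ≤ T, v t = u t := by
    intro t ht
    have : k / 2 * (t - T) ≤ 0 := mul_nonpos_of_nonneg_of_nonpos (by positivity) (by linarith)
    simp only [hv]
    rw [max_eq_left ((min_le_left _ _).trans this), add_zero]
  have hmid : ∀ t ∈ Icc T T', v t = R + k / 2 * (t - T) := by
    intro t ht
    have h1 : 0 ≤ k / 2 * (t - T) := mul_nonneg (by positivity) (by linarith [ht.1])
    have h2 : k / 2 * (t - T) ≤ R' - R := by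
      rw [← hkT]
      exact mul_le_mul_of_nonneg_left (by linarith [ht.2]) (by positivity)
    simp only [hv]
    rw [min_eq_left h2, max_eq_right h1, h.eq_plateau t ht.1]
  have hright : ∀ t, T' ≤ t → v t = R' := by
    intro t ht
    have h2 : R' - R ≤ k / 2 * (t - T) := by
      rw [← hkT]
      exact mul_le_mul_of_nonneg_left (by linarith) (by positivity)
    simp only [hv]
    rw [min_eq_right h2, max_eq_right (by linarith), h.eq_plateau t (by linarith)]
    ring
  have hcube : 0 ≤ 2 / 3 * (R' ^ 3 - R ^ 3) / k :=
    div_nonneg (mul_nonneg (by norm_num) (sub_nonneg.2 (pow_le_pow_left₀ hR hR'.le 3))) hk.le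
  have hnew : 0 ≤ (k ^ 2 / 2 + a) * (2 / 3 * (R' ^ 3 - R ^ 3) / k) :=
    mul_nonneg (by positivity) hcube
  obtain ⟨K, hK⟩ := h.lipschitz
  have hlip : ∃ K', LipschitzWith K' v := by
    have h1 : LipschitzWith (Real.toNNReal (k / 2)) fun t ↦ k / 2 * (t - T) := by
      refine LipschitzWith.of_dist_le_mul fun x y ↦ le_of_eq ?_
      rw [Real.coe_toNNReal _ (by positivity), Real.dist_eq, Real.dist_eq, ← mul_sub, abs_mul,
        abs_of_pos (by positivity : 0 < k / 2)]
      ring_nf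
    exact ⟨_, hK.add ((h1.min_const _).const_max _)⟩
  have hint : ∀ x y, IntervalIntegrable (fun t ↦ v t ^ 2) volume x y := fun x y ↦
    (hlip.choose_spec.continuous.pow 2).intervalIntegrable x y
  refine ⟨v, T', h.length_nonneg.trans hTT'.le, add_nonneg h.energy_nonneg hnew, hlip,
    fun t ht ↦ (hleft t (ht.trans h.length_nonneg)).trans (h.eq_zero t ht), hright, ?_, ?_⟩
  · rw [← intervalIntegral.integral_add_adjacent_intervals (b := T)
      (hint _ _) (hint _ _),
      ← integral_affine_sq hk hT', ← h.mass]
    congr 1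
    · refine intervalIntegral.integral_congr fun t ht ↦ ?_
      rw [uIcc_of_le h.length_nonneg] at ht
      simp only [hleft t ht.2]
    · refine intervalIntegral.integral_congr fun t ht ↦ ?_
      rw [uIcc_of_le hTT'.le] at ht
      simp only [hmid t ht]
  · rw [setLIntegral_Ioo_union h.length_nonneg hTT'.le, ENNReal.ofReal_add h.energy_nonneg hnew,
      ← h.energy]
    congr 1
    · refine setLIntegral_congr_fun measurableSet_Ioo fun t ht ↦ ?_
      have : v =ᶠ[𝓝 t] u := by
        filter_upwards [Iio_mem_nhds ht.2] with s hs using hleft s (le_of_lt hs)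
      simp only [sqEnergyDensity, this.deriv_eq, this.eq_of_nhds]
    · have hpt : ∀ t ∈ Ioo T T', sqEnergyDensity c v t =
          ENNReal.ofReal ((k ^ 2 / 2 + a) * (R + k / 2 * (t - T)) ^ 2) := by
        intro t ht
        have h1 : HasDerivAt (fun t ↦ R + k / 2 * (t - T)) (k / 2) t := by
          simpa using (((hasDerivAt_id t).sub_const T).const_mul (k / 2)).const_add R
        have h2 : v =ᶠ[𝓝 t] fun t ↦ R + k / 2 * (t - T) := by
          filter_upwards [Icc_mem_nhds ht.1 ht.2] with s hs using hmid s hs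
        have h3 : R + k / 2 * (t - T) ∈ Ioo R R' := by
          have e1 : 0 < k / 2 * (t - T) := mul_pos (by positivity) (by linarith [ht.1])
          have e2 : k / 2 * (t - T) < R' - R := by
            rw [← hkT]
            exact mul_lt_mul_of_pos_left (by linarith [ht.2]) (by positivity)
          constructor <;> linarith
        simp only [sqEnergyDensity, h2.deriv_eq, h2.eq_of_nhds, h1.deriv, hc _ h3]
        congr 1
        ring
      rw [setLIntegral_congr_fun measurableSet_Ioo hpt, restrict_Ioo_eq_restrict_Ioc,
        ← integral_affine_sq hk hT', ← intervalIntegral.integral_const_mul,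
        intervalIntegral.integral_of_le hTT'.le, ofReal_integral_eq_lintegral_ofReal]
      · refine Continuous.integrableOn_Ioc ?_
        fun_prop
      · exact Eventually.of_forall fun t ↦ by positivity

theorem exists_isRise {c : ℝ → ℝ} {r k a : ℕ → ℝ} (hr0 : r 0 = 0) (m : ℕ)
    (hr : ∀ i, 1 ≤ i → i ≤ m → r (i - 1) < r i) (hk : ∀ i, 1 ≤ i → i ≤ m → 0 < k i)
    (ha : ∀ i, 1 ≤ i → i ≤ m → 0 ≤ a i)
    (hc : ∀ i, 1 ≤ i → i ≤ m → ∀ s ∈ Ioo (r (i - 1)) (r i), c (s ^ 2) = a i * s ^ 2) :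
    0 ≤ r m ∧ ∃ u T, IsRise c u T (r m)
      (∑ i ∈ Finset.Ico 1 (m + 1), 2 / 3 * (r i ^ 3 - r (i - 1) ^ 3) / k i)
      (∑ i ∈ Finset.Ico 1 (m + 1),
        (k i ^ 2 / 2 + a i) * (2 / 3 * (r i ^ 3 - r (i - 1) ^ 3) / k i)) := by
  induction m with
  | zero => exact ⟨hr0.ge, _, _, by simpa [hr0] using isRise_zero c⟩
  | succ m ih =>
    obtain ⟨h0, u, T, h⟩ := ih (fun i h1 h2 ↦ hr i h1 (by omega)) (fun i h1 h2 ↦ hk i h1 (by omega))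
      (fun i h1 h2 ↦ ha i h1 (by omega)) (fun i h1 h2 ↦ hc i h1 (by omega))
    have h1 := hr (m + 1) (by omega) le_rfl
    have h2 := hc (m + 1) (by omega) le_rfl
    rw [Nat.add_sub_cancel] at h1 h2
    refine ⟨h0.trans h1.le, ?_⟩
    rw [Finset.sum_Ico_succ_top (Nat.le_add_left 1 m),
      Finset.sum_Ico_succ_top (Nat.le_add_left 1 m), Nat.add_sub_cancel]
    exact h.extend (hk (m + 1) (by omega) le_rfl) (ha (m + 1) (by omega) le_rfl) h0 h1 h2

theorem lintegral_comp_abs (F : ℝ → ENNReal) : ∫⁻ y, F |y| = 2 * ∫⁻ y in Ioi 0, F y := by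
  have h1 : ∫⁻ y in Ioi 0, F |y| = ∫⁻ y in Ioi 0, F y :=
    setLIntegral_congr_fun measurableSet_Ioi fun y hy ↦ by
      simp only [abs_of_pos (show (0 : ℝ) < y from hy)]
  have h2 : ∫⁻ y in Iic 0, F |y| = ∫⁻ y in Ioi 0, F y := by
    rw [← restrict_Iio_eq_restrict_Iic]
    have := (Measure.measurePreserving_neg (volume : Measure ℝ)).setLIntegral_comp_preimage_emb
      (Homeomorph.neg ℝ).measurableEmbedding F (Ioi 0)
    rw [← this, neg_preimage, neg_Ioi, neg_zero]
    exact setLIntegral_congr_fun measurableSet_Iio fun y hy ↦ by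
      simp only [abs_of_neg (show y < 0 from hy)]
  rw [← lintegral_add_compl _ measurableSet_Ioi, compl_Ioi, h1, h2, two_mul]

theorem lipschitzWith_sub_abs (x₀ : ℝ) : LipschitzWith 1 fun y : ℝ ↦ x₀ - |y| :=
  LipschitzWith.of_dist_le_mul fun x y ↦ by
    rw [Real.dist_eq, Real.dist_eq, NNReal.coe_one, one_mul, sub_sub_sub_cancel_left, abs_sub_comm]
    exact abs_abs_sub_abs_le _ _

/-- Two mirrored flanks joined by a plateau of half-length `L` form a phase field. -/
theorem IsRise.isPhaseField {c u : ℝ → ℝ} {T R M E L : ℝ} (h : IsRise c u T R M E) (hL : 0 ≤ L) :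
    IsPhaseField (2 * (M + L * R ^ 2)) fun y ↦ u (T + L - |y|) ^ 2 := by
  obtain ⟨K, hK⟩ := h.lipschitz
  have hlip := hK.comp (lipschitzWith_sub_abs (T + L))
  have hcont : Continuous fun y ↦ u (T + L - |y|) ^ 2 := hlip.continuous.pow 2
  have hint : ∀ x y, IntervalIntegrable (fun t ↦ u t ^ 2) volume x y := fun x y ↦
    (hK.continuous.pow 2).intervalIntegrable x y
  have hT := h.length_nonneg
  refine ⟨fun x y ↦ ?_, ?_, ?_⟩
  · have := (hlip.lipschitzOnWith (s := uIcc x y)).absolutelyContinuousOnInterval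
    simpa only [sq, Function.comp_def] using this.fun_mul this
  · refine hcont.integrable_of_hasCompactSupport
      (HasCompactSupport.intro (isCompact_Icc (a := -(T + L)) (b := T + L)) fun y hy ↦ ?_)
    rw [mem_Icc, ← abs_le, not_le] at hy
    rw [h.eq_zero _ (by linarith), zero_pow two_ne_zero]
  · rw [integral_comp_abs (f := fun y ↦ u (T + L - y) ^ 2)]
    have h1 : ∫ y in Ioi 0, u (T + L - y) ^ 2 = ∫ y in Ioc 0 (T + L), u (T + L - y) ^ 2 := by
      refine setIntegral_eq_of_subset_of_forall_sdiff_eq_zero measurableSet_Ioi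
        (fun y hy ↦ hy.1) fun y hy ↦ ?_
      have : T + L < y := not_le.1 fun h' ↦ hy.2 ⟨hy.1, h'⟩
      rw [h.eq_zero _ (by linarith), zero_pow two_ne_zero]
    rw [h1, ← intervalIntegral.integral_of_le (by linarith),
      intervalIntegral.integral_comp_sub_left (fun t ↦ u t ^ 2), sub_self, sub_zero,
      ← intervalIntegral.integral_add_adjacent_intervals (b := T)
        (hint _ _) (hint _ _), h.mass]
    have h2 : ∫ t in T..T + L, u t ^ 2 = ∫ _ in T..T + L, R ^ 2 := by
      refine intervalIntegral.integral_congr fun t ht ↦ ?_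
      rw [uIcc_of_le (by linarith)] at ht
      simp only [h.eq_plateau t ht.1]
    rw [h2, intervalIntegral.integral_const, smul_eq_mul]
    ring

theorem IsRise.phaseFieldEnergy_eq {c u : ℝ → ℝ} {T R M E L : ℝ} (h : IsRise c u T R M E)
    (hL : 0 ≤ L) (hc0 : c 0 = 0) (hcR : 0 ≤ c (R ^ 2)) :
    phaseFieldEnergy c (fun y ↦ u (T + L - |y|) ^ 2) =
      ENNReal.ofReal (2 * (E + L * c (R ^ 2))) := by
  obtain ⟨K, hK⟩ := h.lipschitz
  have hT := h.length_nonneg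
  have hlip := hK.comp (lipschitzWith_sub_abs (T + L))
  -- Almost everywhere the energy density is that of the flank at the reflected point.
  have hdens : phaseFieldEnergy c (fun y ↦ u (T + L - |y|) ^ 2) =
      ∫⁻ y, sqEnergyDensity c u (T + L - |y|) := by
    refine lintegral_congr_ae ?_
    have hne : ∀ᵐ y : ℝ, y ≠ 0 := by simp [ae_iff]
    filter_upwards [hlip.ae_differentiableAt_real, hne] with y hy hy0
    have h1 : deriv (fun y ↦ u (T + L - |y|) ^ 2) y =
        2 * u (T + L - |y|) * deriv (fun y ↦ u (T + L - |y|)) y := by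
      have := (hy.hasDerivAt.fun_pow 2).deriv
      simpa [Function.comp_def] using this
    have h2 : deriv (fun y ↦ u (T + L - |y|)) y ^ 2 = deriv u (T + L - |y|) ^ 2 := by
      rcases lt_or_gt_of_ne hy0 with hneg | hpos
      · have : (fun y ↦ u (T + L - |y|)) =ᶠ[𝓝 y] fun y ↦ u (T + L + y) := by
          filter_upwards [Iio_mem_nhds hneg] with s hs
          rw [abs_of_neg hs, sub_neg_eq_add]
        rw [this.deriv_eq, deriv_comp_const_add, abs_of_neg hneg, sub_neg_eq_add]
      · have : (fun y ↦ u (T + L - |y|)) =ᶠ[𝓝 y] fun y ↦ u (T + L - y) := by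
          filter_upwards [Ioi_mem_nhds hpos] with s hs
          rw [abs_of_pos hs]
        rw [this.deriv_eq, deriv_comp_const_sub, abs_of_pos hpos, neg_sq]
    simp only [sqEnergyDensity, h1, sq_abs, mul_pow, h2, abs_of_nonneg (sq_nonneg (u _))]
  rw [hdens, lintegral_comp_abs (fun y ↦ sqEnergyDensity c u (T + L - y))]
  have hrefl : ∫⁻ y in Ioi 0, sqEnergyDensity c u (T + L - y) =
      ∫⁻ t in Iio (T + L), sqEnergyDensity c u t := by
    have := (Measure.measurePreserving_sub_left (volume : Measure ℝ)
      (T + L)).setLIntegral_comp_preimage_emb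
      (Homeomorph.subLeft (T + L)).measurableEmbedding (sqEnergyDensity c u) (Iio (T + L))
    rw [← this]
    congr 2
    ext y
    simp
  have hsub : ∫⁻ t in Iio (T + L), sqEnergyDensity c u t =
      ∫⁻ t in Ioo 0 (T + L), sqEnergyDensity c u t := by
    rw [← Iio_union_Ico_eq_Iio (a := 0) (by linarith : 0 ≤ T + L),
      lintegral_union measurableSet_Ico, setLIntegral_congr Ioo_ae_eq_Ico]
    · have hz : ∀ t ∈ Iio (0 : ℝ), sqEnergyDensity c u t = 0 := by
        intro t ht
        have : u =ᶠ[𝓝 t] fun _ ↦ 0 := by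
          filter_upwards [Iio_mem_nhds ht] with s hs using h.eq_zero s (le_of_lt hs)
        simp [sqEnergyDensity, this.eq_of_nhds, hc0]
      rw [setLIntegral_congr_fun measurableSet_Iio hz]
      simp
    · exact Set.disjoint_left.2 fun t ht ht' ↦ absurd ht'.1 (not_le.2 ht)
  have hplat : ∫⁻ t in Ioo T (T + L), sqEnergyDensity c u t = ENNReal.ofReal (L * c (R ^ 2)) := by
    have hz : ∀ t ∈ Ioo T (T + L), sqEnergyDensity c u t = ENNReal.ofReal (c (R ^ 2)) := by
      intro t ht
      have : u =ᶠ[𝓝 t] fun _ ↦ R := by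
        filter_upwards [Ioi_mem_nhds ht.1] with s hs using h.eq_plateau s (le_of_lt hs)
      simp [sqEnergyDensity, this.eq_of_nhds, this.deriv_eq]
    rw [setLIntegral_congr_fun measurableSet_Ioo hz, setLIntegral_const, Real.volume_Ioo,
      add_sub_cancel_left, ENNReal.ofReal_mul hL, mul_comm]
  rw [hrefl, hsub, setLIntegral_Ioo_union hT (by linarith), h.energy, hplat,
    ← ENNReal.ofReal_add h.energy_nonneg (by positivity), ENNReal.ofReal_mul (by norm_num)]
  simp

/-! ### Step costs and the lower bound by affine costs -/

theorem mem_pieceIndices_of_lt {N : ℕ∞} {i j : ℕ} (hi : 1 ≤ i) (hij : i ≤ j)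
    (hj : j ∈ pieceIndices N) : i ∈ pieceIndices N :=
  ⟨hi, (Nat.cast_le.2 hij).trans hj.2⟩

theorem succ_mem_pieceIndices {N : ℕ∞} {j : ℕ} : j + 1 ∈ pieceIndices N ↔ (j : ℕ∞) < N := by
  simp only [pieceIndices, mem_ofPred_eq, le_add_iff_nonneg_left, zero_le, true_and, Nat.cast_add,
    Nat.cast_one]
  exact Order.add_one_le_iff_of_not_isMax (by simp)

theorem natCast_lt_of_lt {N : ℕ∞} {i j : ℕ} (hij : i < j) (hj : j ∈ pieceIndices N) :
    (i : ℕ∞) < N :=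
  (Nat.cast_lt.2 hij).trans_le hj.2

/-- The pieces cover `[0, ∞)`, up to the points beyond all `p_i` if there are infinitely many. -/
theorem IsPartition.exists_mem_piece {N : ℕ∞} {p : ℕ → ℝ} (h : IsPartition N p) (hN : 1 ≤ N)
    {x : ℝ} (hx : 0 ≤ x) :
    (∃ i ∈ pieceIndices N, x ∈ piece N p i) ∨ (N = ⊤ ∧ ∀ i, p i ≤ x) := by
  classical
  by_cases hex : ∃ i : ℕ, (i : ℕ∞) < N ∧ x < p i
  · left
    have h1 := Nat.find_spec hex
    have h0 : Nat.find hex ≠ 0 := fun h0 ↦ by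
      rw [h0, h.zero] at h1
      exact absurd h1.2 (not_lt.2 hx)
    refine ⟨Nat.find hex, ⟨by omega, h1.1.le⟩, not_lt.1 fun hlt ↦ ?_, fun _ ↦ h1.2⟩
    exact Nat.find_min hex (m := Nat.find hex - 1) (by omega)
      ⟨(Nat.cast_lt.2 (by omega)).trans h1.1, hlt⟩
  · push Not at hex
    induction N with
    | top => exact Or.inr ⟨rfl, fun i ↦ hex i (ENat.natCast_lt_top i)⟩
    | coe n =>
      have hn : 1 ≤ n := by exact_mod_cast hN
      refine Or.inl ⟨n, ⟨hn, le_rfl⟩, hex (n - 1) (by exact_mod_cast (by omega : n - 1 < n)),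
        fun hlt ↦ absurd hlt (lt_irrefl _)⟩

section StepData

variable {N : ℕ∞} {a φ : ℕ → ℝ}

theorem IsPartition.lt (h : IsPartition N φ) {i : ℕ} (hi : 1 ≤ i) (hiN : (i : ℕ∞) < N) :
    φ (i - 1) < φ i :=
  h.strictMono (show ((i - 1 : ℕ) : ℕ∞) < N from (Nat.cast_le.2 (Nat.sub_le i 1)).trans_lt hiN) hiN
    (by omega)

theorem IsPartition.mono (h : IsPartition N φ) {i j : ℕ} (hij : i ≤ j) (hj : (j : ℕ∞) < N) :
    φ i ≤ φ j :=
  h.strictMono.monotoneOn (show (i : ℕ∞) < N from (Nat.cast_le.2 hij).trans_lt hj) hj hij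

theorem IsPartition.nonneg (h : IsPartition N φ) {i : ℕ} (hi : (i : ℕ∞) < N) : 0 ≤ φ i :=
  h.zero ▸ h.mono (Nat.zero_le i) hi

theorem IsPartition.pos (h : IsPartition N φ) {i : ℕ} (hi : 1 ≤ i) (hiN : (i : ℕ∞) < N) :
    0 < φ i :=
  (h.nonneg ((Nat.cast_le.2 (Nat.sub_le i 1)).trans_lt hiN)).trans_lt (h.lt hi hiN)

theorem IsPartition.rpow_sub_pos (h : IsPartition N φ) {i : ℕ} (hi : 1 ≤ i) (hiN : (i : ℕ∞) < N) :
    0 < φ i ^ (3 / 2 : ℝ) - φ (i - 1) ^ (3 / 2 : ℝ) :=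
  sub_pos.2 (Real.rpow_lt_rpow (h.nonneg ((Nat.cast_le.2 (Nat.sub_le i 1)).trans_lt hiN))
    (h.lt hi hiN) (by norm_num))

theorem IsStepData.lt (h : IsStepData N a φ) {i j : ℕ} (hi : 1 ≤ i) (hij : i < j)
    (hj : j ∈ pieceIndices N) : a j < a i :=
  h.strictAnti (mem_pieceIndices_of_lt hi hij.le hj) hj hij

theorem IsStepData.affineCost_nonneg (h : IsStepData N a φ) {j : ℕ} (hj : j ∈ pieceIndices N)
    {w : ℝ} (hw : 0 ≤ w) : 0 ≤ affineCost a φ j w := by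
  refine add_nonneg (mul_nonneg hw (h.nonneg j hj)) (mul_nonneg (by positivity)
    (Finset.sum_nonneg fun i hi ↦ ?_))
  obtain ⟨h1, h2⟩ := Finset.mem_Ico.1 hi
  exact mul_nonneg (Real.sqrt_nonneg _) (h.partition.rpow_sub_pos h1 (natCast_lt_of_lt h2 hj)).le

/-- The mass at which the affine costs with indices `j` and `j + 1` agree. -/
noncomputable def crossingMass (a φ : ℕ → ℝ) (j : ℕ) : ℝ :=
  4 * √2 / 3 * ∑ i ∈ Finset.Ico 1 (j + 1), (φ i ^ (3 / 2 : ℝ) - φ (i - 1) ^ (3 / 2 : ℝ)) /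
    (√(a i - a (j + 1)) + √(a i - a j))

/-- The difference of square roots is rationalized by `√x - √y = (x - y) / (√x + √y)`. -/
theorem affineCost_succ_sub {j : ℕ} (hj : 1 ≤ j) (ha : ∀ i, 1 ≤ i → i ≤ j → a j ≤ a i)
    (hlt : a (j + 1) < a j) (w : ℝ) :
    affineCost a φ (j + 1) w - affineCost a φ j w =
      (a j - a (j + 1)) * (crossingMass a φ j - w) := by
  have h1 : ∑ i ∈ Finset.Ico 1 j, √(a i - a j) * (φ i ^ (3 / 2 : ℝ) - φ (i - 1) ^ (3 / 2 : ℝ)) =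
      ∑ i ∈ Finset.Ico 1 (j + 1),
        √(a i - a j) * (φ i ^ (3 / 2 : ℝ) - φ (i - 1) ^ (3 / 2 : ℝ)) := by
    rw [Finset.sum_Ico_succ_top hj, sub_self, Real.sqrt_zero, zero_mul, add_zero]
  have h2 : ∀ i ∈ Finset.Ico 1 (j + 1),
      √(a i - a (j + 1)) * (φ i ^ (3 / 2 : ℝ) - φ (i - 1) ^ (3 / 2 : ℝ)) =
      √(a i - a j) * (φ i ^ (3 / 2 : ℝ) - φ (i - 1) ^ (3 / 2 : ℝ)) +
      (a j - a (j + 1)) * ((φ i ^ (3 / 2 : ℝ) - φ (i - 1) ^ (3 / 2 : ℝ)) /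
        (√(a i - a (j + 1)) + √(a i - a j))) := by
    intro i hi
    obtain ⟨hi1, hi2⟩ := Finset.mem_Ico.1 hi
    have hai := ha i hi1 (by omega)
    have hpos : 0 < √(a i - a (j + 1)) + √(a i - a j) :=
      add_pos_of_pos_of_nonneg (Real.sqrt_pos.2 (by linarith)) (Real.sqrt_nonneg _)
    have e1 := Real.sq_sqrt (show 0 ≤ a i - a (j + 1) by linarith)
    have e2 := Real.sq_sqrt (show 0 ≤ a i - a j by linarith)
    have e3 : a j - a (j + 1) =
        (√(a i - a (j + 1)) - √(a i - a j)) * (√(a i - a (j + 1)) + √(a i - a j)) := by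
      nlinarith
    rw [e3]
    field_simp
    ring
  simp only [affineCost, crossingMass]
  rw [h1, Finset.sum_congr rfl h2, Finset.sum_add_distrib, ← Finset.mul_sum]
  ring

theorem IsStepData.affineCost_succ_sub (h : IsStepData N a φ) {j : ℕ} (hj : 1 ≤ j)
    (hjN : (j : ℕ∞) < N) (w : ℝ) :
    affineCost a φ (j + 1) w - affineCost a φ j w =
      (a j - a (j + 1)) * (crossingMass a φ j - w) := by
  have hj' := succ_mem_pieceIndices.2 hjN
  refine _root_.affineCost_succ_sub hj (fun i h1 h2 ↦ ?_) (h.lt hj (Nat.lt_succ_self j) hj') w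
  exact h.strictAnti.antitoneOn (mem_pieceIndices_of_lt h1 (by omega) hj')
    (mem_pieceIndices_of_lt hj (by omega) hj') h2

theorem IsStepCost.eq_mul {c : ℝ → ℝ} (hc : IsStepCost N a φ c) {i : ℕ} (hi : i ∈ pieceIndices N)
    {x : ℝ} (hx : x ∈ piece N φ i) (hx0 : 0 < x) : c x = a i * x :=
  (div_eq_iff hx0.ne').1 (hc.step i hi x hx hx0)

theorem IsStepData.iInf_le (h : IsStepData ⊤ a φ) (i : ℕ) : ⨅ i : ℕ, a (i + 1) ≤ a (i + 1) :=
  ciInf_le ⟨0, by rintro _ ⟨i, rfl⟩; exact h.nonneg _ ⟨by omega, le_top⟩⟩ i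

theorem IsStepData.iInf_nonneg (h : IsStepData ⊤ a φ) : 0 ≤ ⨅ i : ℕ, a (i + 1) :=
  le_ciInf fun _ ↦ h.nonneg _ ⟨by omega, le_top⟩

theorem IsStepCost.mul_le_of_lt {c : ℝ → ℝ} (hc : IsStepCost N a φ c) (h : IsStepData N a φ)
    {j : ℕ} (hj : j ∈ pieceIndices N) {x : ℝ} (hx : 0 ≤ x) (hxj : (j : ℕ∞) < N → x < φ j) :
    a j * x ≤ c x := by
  rcases hx.eq_or_lt with rfl | hx0
  · simp [hc.zero]
  rcases h.partition.exists_mem_piece h.nonempty hx with ⟨i, hi, hxi⟩ | ⟨hN, hall⟩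
  · rw [hc.eq_mul hi hxi hx0]
    refine mul_le_mul_of_nonneg_right (h.strictAnti.antitoneOn hi hj (not_lt.1 fun hlt ↦ ?_)) hx
    have hjN := natCast_lt_of_lt hlt hi
    have := h.partition.mono (Nat.le_sub_one_of_lt hlt)
      (natCast_lt_of_lt (by omega : i - 1 < i) hi)
    exact absurd (hxj hjN) (not_lt.2 (this.trans hxi.1))
  · subst hN
    exact absurd (hxj (ENat.natCast_lt_top j)) (not_lt.2 (hall j))

theorem IsStepCost.iInf_mul_le {c : ℝ → ℝ} (hc : IsStepCost ⊤ a φ c) (h : IsStepData ⊤ a φ)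
    {x : ℝ} (hx : 0 ≤ x) : (⨅ i : ℕ, a (i + 1)) * x ≤ c x := by
  rcases hx.eq_or_lt with rfl | hx0
  · simp [hc.zero]
  rcases h.partition.exists_mem_piece h.nonempty hx with ⟨i, hi, hxi⟩ | ⟨-, hall⟩
  · rw [hc.eq_mul hi hxi hx0]
    have := h.iInf_le (i - 1)
    rw [Nat.sub_add_cancel hi.1] at this
    exact mul_le_mul_of_nonneg_right this hx
  · rw [(div_eq_iff hx0.ne').1 (hc.tail rfl x hall)]

theorem IsStepData.level {c : ℝ → ℝ} (h : IsStepData N a φ) (hc : IsStepCost N a φ c) {i : ℕ}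
    (hi : 1 ≤ i) (hiN : (i : ℕ∞) < N) : ∀ s ∈ Ioo (φ (i - 1)) (φ i), c s = a i * s :=
  fun _ hs ↦ hc.eq_mul ⟨hi, hiN.le⟩ ⟨hs.1.le, fun _ ↦ hs.2⟩
    ((h.partition.nonneg ((Nat.cast_le.2 (Nat.sub_le i 1)).trans_lt hiN)).trans_lt hs.1)

/-- If `j` is the first index for which the phase field stays below `φ_j`, then its energy is at
least the affine cost with index `j`; if there is none, the same argument applies with the slope
`a_N` or, among infinitely many indices, with `lim a_i`. -/
theorem IsStepCost.exists_affineCost_le {c : ℝ → ℝ} (hc : IsStepCost N a φ c)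
    (h : IsStepData N a φ) {w : ℝ} (hw : 0 ≤ w) {ψ : ℝ → ℝ} (hψ : IsPhaseField w ψ) {ε : ℝ}
    (hε : 0 < ε) : ∃ j ∈ pieceIndices N,
      ENNReal.ofReal (affineCost a φ j w) ≤ phaseFieldEnergy c ψ + ENNReal.ofReal ε := by
  classical
  have main : ∀ j ∈ pieceIndices N, (∀ t, (j : ℕ∞) < N → |ψ t| < φ j) →
      (1 < j → ∃ x₀, φ (j - 1) ≤ |ψ x₀|) →
      ENNReal.ofReal (affineCost a φ j w) ≤ phaseFieldEnergy c ψ := fun j hj hb hr ↦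
    energy_lower_bound hψ (h.nonneg j hj) h.partition.zero.ge
      (fun i h1 h2 ↦ h.partition.lt h1 (natCast_lt_of_lt h2 hj))
      (fun i h1 h2 ↦ (h.lt h1 h2 hj).le)
      (fun i h1 h2 ↦ h.level hc h1 (natCast_lt_of_lt h2 hj))
      (fun t ↦ hc.mul_le_of_lt h hj (abs_nonneg _) (hb t)) hr
  by_cases hex : ∃ j : ℕ, (j : ℕ∞) < N ∧ ∀ t, |ψ t| < φ j
  · obtain ⟨h1, h2⟩ := Nat.find_spec hex
    have h0 : Nat.find hex ≠ 0 := fun h0 ↦ by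
      have := h2 0
      rw [h0, h.partition.zero] at this
      exact absurd this (not_lt.2 (abs_nonneg _))
    refine ⟨Nat.find hex, ⟨by omega, h1.le⟩, (main _ ⟨by omega, h1.le⟩ (fun t _ ↦ h2 t)
      fun _ ↦ ?_).trans le_self_add⟩
    have h3 := Nat.find_min hex (m := Nat.find hex - 1) (by omega)
    by_contra! hcon
    exact h3 ⟨(Nat.cast_lt.2 (by omega)).trans h1, hcon⟩
  · push Not at hex
    induction N with
    | coe n =>
      have hn : 1 ≤ n := by exact_mod_cast h.nonempty
      refine ⟨n, ⟨hn, le_rfl⟩, (main n ⟨hn, le_rfl⟩ (fun t hlt ↦ absurd hlt (lt_irrefl _))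
        fun _ ↦ hex (n - 1) ?_).trans le_self_add⟩
      exact_mod_cast (by omega : n - 1 < n)
    | top =>
      set l := ⨅ i : ℕ, a (i + 1) with hl
      obtain ⟨i, hi⟩ := exists_lt_of_ciInf_lt
        (show ⨅ i : ℕ, a (i + 1) < l + ε / (w + 1) by rw [← hl]; simp; positivity)
      refine ⟨i + 1, ⟨by omega, le_top⟩, ?_⟩
      have hle : ∀ i, 1 ≤ i → l ≤ a i := fun i hi ↦ by
        simpa [Nat.sub_add_cancel hi] using h.iInf_le (i - 1)
      have hlow := energy_lower_bound (J := i + 1) hψ h.iInf_nonneg h.partition.zero.ge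
        (fun i h1 _ ↦ h.partition.lt h1 (ENat.natCast_lt_top i)) (fun i h1 _ ↦ hle i h1)
        (fun i h1 _ ↦ h.level hc h1 (ENat.natCast_lt_top i))
        (fun t ↦ hc.iInf_mul_le h (abs_nonneg _)) (fun _ ↦ hex _ (ENat.natCast_lt_top _))
      refine le_trans ?_ (add_le_add_left hlow _)
      refine le_trans (ENNReal.ofReal_le_ofReal ?_) ENNReal.ofReal_add_le
      have hsum : ∑ k ∈ Finset.Ico 1 (i + 1),
          √(a k - a (i + 1)) * (φ k ^ (3 / 2 : ℝ) - φ (k - 1) ^ (3 / 2 : ℝ)) ≤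
          ∑ k ∈ Finset.Ico 1 (i + 1),
          √(a k - l) * (φ k ^ (3 / 2 : ℝ) - φ (k - 1) ^ (3 / 2 : ℝ)) := by
        refine Finset.sum_le_sum fun k hk ↦ mul_le_mul_of_nonneg_right
          (Real.sqrt_le_sqrt ?_) (h.partition.rpow_sub_pos (Finset.mem_Ico.1 hk).1
            (ENat.natCast_lt_top k)).le
        linarith [hle (i + 1) (by omega)]
      have hw1 : w * a (i + 1) ≤ w * l + ε := by
        have e1 : w * a (i + 1) ≤ w * (l + ε / (w + 1)) := mul_le_mul_of_nonneg_left hi.le hw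
        have e2 : w * (ε / (w + 1)) ≤ ε := by
          rw [mul_div_assoc', div_le_iff₀ (by positivity)]
          nlinarith
        linarith
      have := mul_le_mul_of_nonneg_left hsum (show 0 ≤ 4 * √2 / 3 by positivity)
      simp only [affineCost]
      linarith

end StepData

/-! ### Upper bound by affine costs and the induced cost -/

theorem Real.sqrt_pow_three {x : ℝ} (hx : 0 ≤ x) : √x ^ 3 = x ^ (3 / 2 : ℝ) := by
  rw [Real.sqrt_eq_rpow, ← Real.rpow_natCast, ← Real.rpow_mul hx]
  norm_num

theorem Real.sq_mem_Ioo_of_mem_Ioo_sqrt {x y s : ℝ} (hx : 0 ≤ x) (hs : s ∈ Ioo √x √y) :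
    s ^ 2 ∈ Ioo x y := by
  have hs0 : 0 ≤ s := (Real.sqrt_nonneg x).trans hs.1.le
  constructor
  · rw [← Real.sq_sqrt hx]
    exact pow_lt_pow_left₀ hs.1 (Real.sqrt_nonneg x) two_ne_zero
  · exact (Real.lt_sqrt hs0).1 hs.2

theorem isPhaseField_zero : IsPhaseField 0 fun _ ↦ 0 where
  absCont x y := (LipschitzWith.const (0 : ℝ)).lipschitzOnWith.absolutelyContinuousOnInterval
  integrable := integrable_zero _ _ _
  mass := by simp

section StepData

variable {N : ℕ∞} {a φ : ℕ → ℝ}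

/-- Flat and wide phase fields have an energy close to `w a_1`. -/
theorem IsStepCost.iInf_energy_le_one {c : ℝ → ℝ} (hc : IsStepCost N a φ c)
    (h : IsStepData N a φ) {w : ℝ} (hw : 0 ≤ w) :
    ⨅ (ψ : ℝ → ℝ) (_ : IsPhaseField w ψ), phaseFieldEnergy c ψ ≤ ENNReal.ofReal (w * a 1) := by
  have hone : 1 ∈ pieceIndices N := ⟨le_rfl, by simpa using h.nonempty⟩
  have ha1 := h.nonneg 1 hone
  rcases hw.eq_or_lt with rfl | hw
  · refine (iInf₂_le _ isPhaseField_zero).trans ?_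
    simp [phaseFieldEnergy, hc.zero]
  have hsmall : ∀ᶠ s : ℝ in 𝓝[>] 0, (1 : ℕ∞) < N → s ^ 2 < φ 1 := by
    by_cases hN : (1 : ℕ∞) < N
    · have hpos : (0 : ℝ) ^ 2 < φ 1 := by
        simpa using h.partition.pos le_rfl (by simpa using hN)
      have : ∀ᶠ s : ℝ in 𝓝 0, s ^ 2 < φ 1 :=
        ((continuous_pow 2).tendsto (0 : ℝ)).eventually_lt_const hpos
      exact (this.filter_mono nhdsWithin_le_nhds).mono fun s hs _ ↦ hs
    · exact Eventually.of_forall fun s hs ↦ absurd hs hN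
  have hlim : Tendsto (fun s : ℝ ↦ ENNReal.ofReal (((4 / 3 * s ^ 3 / w) ^ 2 / 2 + a 1) * w))
      (𝓝[>] 0) (𝓝 (ENNReal.ofReal (w * a 1))) := by
    have hcont : Continuous fun s : ℝ ↦
        ENNReal.ofReal (((4 / 3 * s ^ 3 / w) ^ 2 / 2 + a 1) * w) :=
      ENNReal.continuous_ofReal.comp (by fun_prop)
    have := hcont.tendsto 0
    simp only [ne_eq, OfNat.ofNat_ne_zero, not_false_eq_true, zero_pow, mul_zero, zero_div,
      zero_add] at this
    rw [mul_comm w]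
    exact tendsto_nhdsWithin_of_tendsto_nhds this
  refine ge_of_tendsto hlim ?_
  filter_upwards [hsmall, self_mem_nhdsWithin] with s hs (hs0 : 0 < s)
  have hstep : ∀ t ∈ Ioc 0 s, c (t ^ 2) = a 1 * t ^ 2 := fun t ht ↦
    hc.eq_mul hone ⟨by simpa [h.partition.zero] using sq_nonneg t, fun hN ↦
      (pow_le_pow_left₀ ht.1.le ht.2 2).trans_lt (hs (by simpa using hN))⟩ (pow_pos ht.1 2)
  -- The slope is chosen such that the two flanks without plateau have mass `w`.
  have hk : 0 < 4 / 3 * s ^ 3 / w := by positivity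
  obtain ⟨u, T, hu⟩ := (isRise_zero c).extend hk ha1 le_rfl hs0
    fun t ht ↦ hstep t ⟨ht.1, ht.2.le⟩
  have hcs : 0 ≤ c (s ^ 2) := by
    rw [hstep s ⟨hs0, le_rfl⟩]
    positivity
  have hpf := hu.isPhaseField le_rfl
  have hen := hu.phaseFieldEnergy_eq le_rfl hc.zero hcs
  have e1 : 2 * (0 + 2 / 3 * (s ^ 3 - 0 ^ 3) / (4 / 3 * s ^ 3 / w) + 0 * s ^ 2) = w := by
    field_simp
    ring
  have e2 : 2 * (0 + ((4 / 3 * s ^ 3 / w) ^ 2 / 2 + a 1) *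
      (2 / 3 * (s ^ 3 - 0 ^ 3) / (4 / 3 * s ^ 3 / w)) + 0 * c (s ^ 2)) =
      ((4 / 3 * s ^ 3 / w) ^ 2 / 2 + a 1) * w := by
    have : 2 * (2 / 3 * (s ^ 3 - 0 ^ 3) / (4 / 3 * s ^ 3 / w)) = w := by linarith
    linear_combination ((4 / 3 * s ^ 3 / w) ^ 2 / 2 + a 1) * this
  rw [e1] at hpf
  rw [e2] at hen
  exact (iInf₂_le _ hpf).trans hen.le

/-- For masses above the crossing mass, the affine cost with index `j + 1` is the energy of a phase
field with plateau height `φ_j`, whose flanks satisfy `½ψ'² = c(ψ) - a_{j+1} ψ`. -/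
theorem IsStepCost.iInf_energy_le_succ {c : ℝ → ℝ} (hc : IsStepCost N a φ c)
    (h : IsStepData N a φ) {j : ℕ} (hj : 1 ≤ j) (hjN : (j : ℕ∞) < N) {w : ℝ}
    (hw : crossingMass a φ j ≤ w) :
    ⨅ (ψ : ℝ → ℝ) (_ : IsPhaseField w ψ), phaseFieldEnergy c ψ ≤
      ENNReal.ofReal (affineCost a φ (j + 1) w) := by
  have hj1 := succ_mem_pieceIndices.2 hjN
  have hlt : ∀ i, i ≤ j → (i : ℕ∞) < N := fun i hi ↦ natCast_lt_of_lt (by omega) hj1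
  set b := a (j + 1) with hb
  have hab : ∀ i, 1 ≤ i → i ≤ j → b < a i := fun i h1 h2 ↦ h.lt h1 (by omega) hj1
  obtain ⟨-, u, T, hu⟩ := exists_isRise (c := c) (r := fun i ↦ √(φ i))
    (k := fun i ↦ √(2 * (a i - b))) (a := a) (by simp [h.partition.zero]) j
    (fun i h1 h2 ↦ Real.sqrt_lt_sqrt (h.partition.nonneg (hlt _ (by omega)))
      (h.partition.lt h1 (hlt i h2)))
    (fun i h1 h2 ↦ Real.sqrt_pos.2 (by linarith [hab i h1 h2]))
    (fun i h1 h2 ↦ h.nonneg i ⟨h1, (hlt i h2).le⟩)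
    (fun i h1 h2 s hs ↦ h.level hc h1 (hlt i h2) _
      (Real.sq_mem_Ioo_of_mem_Ioo_sqrt (h.partition.nonneg (hlt _ (by omega))) hs))
  have hφj := h.partition.pos hj hjN
  have hcφ : c (φ j) = b * φ j :=
    hc.eq_mul hj1 ⟨le_rfl, fun h' ↦ h.partition.lt (by omega) h'⟩ hφj
  -- Mass and energy of the flanks, expressed through `D i = φ_i^{3/2} - φ_{i-1}^{3/2}`.
  set D : ℕ → ℝ := fun i ↦ φ i ^ (3 / 2 : ℝ) - φ (i - 1) ^ (3 / 2 : ℝ) with hD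
  have hDpos : ∀ i, 1 ≤ i → i ≤ j → 0 < D i := fun i h1 h2 ↦
    h.partition.rpow_sub_pos h1 (hlt i h2)
  have hcube : ∀ i, 1 ≤ i → i ≤ j → √(φ i) ^ 3 - √(φ (i - 1)) ^ 3 = D i := fun i _ h2 ↦ by
    rw [Real.sqrt_pow_three (h.partition.nonneg (hlt _ h2)),
      Real.sqrt_pow_three (h.partition.nonneg (hlt _ (by omega)))]
  set M := ∑ i ∈ Finset.Ico 1 (j + 1),
    2 / 3 * (√(φ i) ^ 3 - √(φ (i - 1)) ^ 3) / √(2 * (a i - b)) with hM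
  set E := ∑ i ∈ Finset.Ico 1 (j + 1), (√(2 * (a i - b)) ^ 2 / 2 + a i) *
    (2 / 3 * (√(φ i) ^ 3 - √(φ (i - 1)) ^ 3) / √(2 * (a i - b))) with hE
  have h2 : √2 ^ 2 = 2 := Real.sq_sqrt (by norm_num)
  have hMle : 2 * M ≤ crossingMass a φ j := by
    rw [hM, crossingMass, Finset.mul_sum, Finset.mul_sum]
    refine Finset.sum_le_sum fun i hi ↦ ?_
    obtain ⟨h1, h1'⟩ := Finset.mem_Ico.1 hi
    have hij : i ≤ j := by omega
    have hs : 0 < √(a i - b) := Real.sqrt_pos.2 (by linarith [hab i h1 hij])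
    have hle : √(a i - a j) ≤ √(a i - b) :=
      Real.sqrt_le_sqrt (by linarith [hab j hj le_rfl])
    rw [hcube i h1 hij, Real.sqrt_mul (by norm_num)]
    calc 2 * (2 / 3 * D i / (√2 * √(a i - b)))
        = 4 * √2 / 3 * (D i / (√(a i - b) + √(a i - b))) := by
          field_simp
          rw [h2]
          ring
      _ ≤ _ := by
          gcongr
          · exact (hDpos i h1 hij).le
  have hEM : 2 * E = 2 * b * M + 4 * √2 / 3 * ∑ i ∈ Finset.Ico 1 (j + 1), √(a i - b) * D i := by
    rw [hE, hM, Finset.mul_sum, Finset.mul_sum, Finset.mul_sum, ← Finset.sum_add_distrib]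
    refine Finset.sum_congr rfl fun i hi ↦ ?_
    obtain ⟨h1, h1'⟩ := Finset.mem_Ico.1 hi
    have hij : i ≤ j := by omega
    have hs : 0 < √(a i - b) := Real.sqrt_pos.2 (by linarith [hab i h1 hij])
    have hsq := Real.mul_self_sqrt (show 0 ≤ a i - b by linarith [hab i h1 hij])
    rw [hcube i h1 hij, Real.sqrt_mul (by norm_num)]
    have hai : a i = b + √(a i - b) * √(a i - b) := by rw [hsq]; ring
    generalize √(a i - b) = s at *
    rw [hai]
    field_simp
    rw [h2]
    ring
  set L := (w / 2 - M) / φ j with hL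
  have hL0 : 0 ≤ L := div_nonneg (by linarith) hφj.le
  have hsqφ : √(φ j) ^ 2 = φ j := Real.sq_sqrt hφj.le
  have hLφ : L * φ j = w / 2 - M := div_mul_cancel₀ _ hφj.ne'
  have hpf := hu.isPhaseField hL0
  have hen := hu.phaseFieldEnergy_eq hL0 hc.zero
    (by rw [hsqφ, hcφ]; exact mul_nonneg (h.nonneg _ hj1) hφj.le)
  have e1 : 2 * (M + L * √(φ j) ^ 2) = w := by rw [hsqφ, hLφ]; ring
  have e2 : 2 * (E + L * c (√(φ j) ^ 2)) = affineCost a φ (j + 1) w := by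
    simp only [affineCost, hsqφ, hcφ]
    linear_combination hEM + 2 * b * hLφ
  rw [e1] at hpf
  rw [e2] at hen
  exact (iInf₂_le _ hpf).trans hen.le

/-- For masses below the crossing mass, the affine cost with index `j` is smaller than the one with
index `j + 1`, so that induction reduces to the case of masses above it. -/
theorem IsStepCost.iInf_energy_le {c : ℝ → ℝ} (hc : IsStepCost N a φ c)
    (h : IsStepData N a φ) {j : ℕ} (hj : j ∈ pieceIndices N) {w : ℝ} (hw : 0 ≤ w) :
    ⨅ (ψ : ℝ → ℝ) (_ : IsPhaseField w ψ), phaseFieldEnergy c ψ ≤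
      ENNReal.ofReal (affineCost a φ j w) := by
  obtain ⟨hj1, hjN⟩ := hj
  induction j, hj1 using Nat.le_induction with
  | base => simpa [affineCost] using hc.iInf_energy_le_one h hw
  | succ j hj1 ih =>
    have hlt : (j : ℕ∞) < N := succ_mem_pieceIndices.1 ⟨by omega, hjN⟩
    rcases le_total (crossingMass a φ j) w with hle | hle
    · exact hc.iInf_energy_le_succ h hj1 hlt hle
    · refine (ih hlt.le).trans (ENNReal.ofReal_le_ofReal (sub_nonneg.1 ?_))
      rw [h.affineCost_succ_sub hj1 hlt]
      exact mul_nonneg (sub_nonneg.2 (h.lt hj1 (Nat.lt_succ_self j)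
        (succ_mem_pieceIndices.2 hlt)).le) (sub_nonneg.2 hle)

theorem IsStepData.isGLB_sInf (h : IsStepData N a φ) {w : ℝ} (hw : 0 ≤ w) :
    IsGLB {t | ∃ j ∈ pieceIndices N, t = affineCost a φ j w}
      (sInf {t | ∃ j ∈ pieceIndices N, t = affineCost a φ j w}) := by
  refine isGLB_csInf ⟨_, 1, ⟨le_rfl, by simpa using h.nonempty⟩, rfl⟩ ⟨0, ?_⟩
  rintro _ ⟨j, hj, rfl⟩
  exact h.affineCost_nonneg hj hw

theorem IsStepCost.induces {c τ : ℝ → ℝ} (hc : IsStepCost N a φ c) (h : IsStepData N a φ)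
    (hτ : ∀ w : ℝ, 0 ≤ w → IsGLB {t | ∃ j ∈ pieceIndices N, t = affineCost a φ j w} (τ w)) :
    Induces c τ := by
  intro w hw
  have hτ0 : 0 ≤ τ w := (hτ w hw).2 (by
    rintro _ ⟨j, hj, rfl⟩
    exact h.affineCost_nonneg hj hw)
  refine ⟨hτ0, le_antisymm (le_iInf₂ fun ψ hψ ↦ ?_) ?_⟩
  · refine ENNReal.le_of_forall_pos_le_add fun ε hε _ ↦ ?_
    obtain ⟨j, hj, hle⟩ := hc.exists_affineCost_le h hw hψ (ε := ε) (by exact_mod_cast hε)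
    rw [ENNReal.ofReal_coe_nnreal] at hle
    exact (ENNReal.ofReal_le_ofReal ((hτ w hw).1 ⟨j, hj, rfl⟩)).trans hle
  · refine ENNReal.le_of_forall_pos_le_add fun ε hε _ ↦ ?_
    obtain ⟨_, ⟨j, hj, rfl⟩, hlt⟩ := (hτ w hw).exists_between
      (lt_add_of_pos_right (τ w) (show (0 : ℝ) < ε by exact_mod_cast hε))
    refine (hc.iInf_energy_le h hj hw).trans ?_
    rw [← ENNReal.ofReal_coe_nnreal, ← ENNReal.ofReal_add hτ0 ε.coe_nonneg]
    exact ENNReal.ofReal_le_ofReal hlt.2.le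

end StepData

/-! ### Piecewise affinity of the induced cost -/

/-- If, on an open interval, no two of finitely many continuous functions are minimal at the same
point, then one of them is minimal throughout: the sets where the individual functions are minimal
form a finite closed partition of a connected set. -/
theorem exists_forall_le_of_no_ties {ι : Type*} [DecidableEq ι] {ℓ : ι → ℝ → ℝ}
    (hℓ : ∀ i, Continuous (ℓ i)) {F : Finset ι} (hF : F.Nonempty) {x y : ℝ} (hxy : x < y)
    (hties : ∀ t ∈ Ioo x y, ∀ i ∈ F, ∀ j ∈ F, i ≠ j → (∀ k ∈ F, ℓ i t ≤ ℓ k t) →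
      ¬ ∀ k ∈ F, ℓ j t ≤ ℓ k t) :
    ∃ j ∈ F, ∀ t ∈ Icc x y, ∀ i ∈ F, ℓ j t ≤ ℓ i t := by
  obtain ⟨z, hz⟩ := nonempty_Ioo.2 hxy
  obtain ⟨j, hj, hjmin⟩ := F.exists_min_image (fun i ↦ ℓ i z) hF
  have hclosed : ∀ j, IsClosed {t | ∀ k ∈ F, ℓ j t ≤ ℓ k t} := fun j ↦ by
    simp only [ofPred_forall]
    exact isClosed_biInter fun k _ ↦ isClosed_le (hℓ j) (hℓ k)
  have hB : IsClosed (⋃ i ∈ F.erase j, {t | ∀ k ∈ F, ℓ i t ≤ ℓ k t}) :=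
    isClosed_biUnion_finset fun i _ ↦ hclosed i
  have hsub : Ioo x y ⊆ {t | ∀ k ∈ F, ℓ j t ≤ ℓ k t} := by
    intro s hs
    by_contra hns
    have hcover : ∀ t, t ∈ {t | ∀ k ∈ F, ℓ j t ≤ ℓ k t} ∪
        ⋃ i ∈ F.erase j, {t | ∀ k ∈ F, ℓ i t ≤ ℓ k t} := by
      intro t
      obtain ⟨i, hi, himin⟩ := F.exists_min_image (fun i ↦ ℓ i t) hF
      by_cases hij : i = j
      · exact Or.inl (hij ▸ himin)
      · exact Or.inr (mem_biUnion (Finset.mem_erase.2 ⟨hij, hi⟩) himin)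
    obtain ⟨t, ht, htA, htB⟩ := isPreconnected_closed_iff.1 isPreconnected_Ioo _ _ (hclosed j) hB
      (fun t _ ↦ hcover t) ⟨z, hz, hjmin⟩ ⟨s, hs, (hcover s).resolve_left hns⟩
    obtain ⟨i, hi, hti⟩ := mem_iUnion₂.1 htB
    obtain ⟨hij, hi⟩ := Finset.mem_erase.1 hi
    exact hties t ht i hi j hj hij hti htA
  refine ⟨j, hj, fun t ht ↦ ?_⟩
  have := closure_minimal hsub (hclosed j)
  rw [closure_Ioo hxy.ne] at this
  exact this ht

section StepData

variable {N : ℕ∞} {a φ : ℕ → ℝ}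

theorem continuous_affineCost (a φ : ℕ → ℝ) (j : ℕ) : Continuous (affineCost a φ j) := by
  unfold affineCost
  fun_prop

theorem IsStepData.affineCost_lt_succ (h : IsStepData N a φ) {j : ℕ} (hj : 1 ≤ j)
    (hjN : (j : ℕ∞) < N) {w : ℝ} (hw : w < crossingMass a φ j) :
    affineCost a φ j w < affineCost a φ (j + 1) w := by
  rw [← sub_pos, h.affineCost_succ_sub hj hjN]
  exact mul_pos (sub_pos.2 (h.lt hj (Nat.lt_succ_self j) (succ_mem_pieceIndices.2 hjN)))
    (sub_pos.2 hw)

theorem IsStepData.tendsto_crossingMass (h : IsStepData ⊤ a φ) (hφ : Tendsto φ atTop atTop) :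
    Tendsto (crossingMass a φ) atTop atTop := by
  have htop : ∀ i : ℕ, (i : ℕ∞) < ⊤ := ENat.natCast_lt_top
  have hmem : ∀ i : ℕ, 1 ≤ i → i ∈ pieceIndices ⊤ := fun i hi ↦ ⟨hi, le_top⟩
  have ha1 : 0 < a 1 := (h.nonneg 2 (hmem 2 (by omega))).trans_lt
    (h.lt le_rfl (by omega) (hmem 2 (by omega)))
  have hanti : ∀ i, 1 ≤ i → a i ≤ a 1 := fun i hi ↦
    h.strictAnti.antitoneOn (hmem 1 le_rfl) (hmem i hi) hi
  have htele : ∀ j, ∑ i ∈ Finset.Ico 1 (j + 1),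
      (φ i ^ (3 / 2 : ℝ) - φ (i - 1) ^ (3 / 2 : ℝ)) = φ j ^ (3 / 2 : ℝ) := by
    intro j
    induction j with
    | zero => simp [h.partition.zero, Real.zero_rpow]
    | succ j ih => rw [Finset.sum_Ico_succ_top (by omega), ih, Nat.add_sub_cancel]; ring
  have hlow : ∀ j, 4 * √2 / 3 * (φ j ^ (3 / 2 : ℝ) / (√(a 1) + √(a 1))) ≤ crossingMass a φ j := by
    intro j
    rw [crossingMass, ← htele, Finset.sum_div]
    refine mul_le_mul_of_nonneg_left (Finset.sum_le_sum fun i hi ↦ ?_) (by positivity)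
    obtain ⟨h1, h2⟩ := Finset.mem_Ico.1 hi
    have hji := h.lt h1 h2 (hmem (j + 1) (by omega))
    refine div_le_div_of_nonneg_left (h.partition.rpow_sub_pos h1 (htop i)).le
      (add_pos_of_pos_of_nonneg (Real.sqrt_pos.2 (sub_pos.2 hji)) (Real.sqrt_nonneg _))
      (add_le_add (Real.sqrt_le_sqrt ?_) (Real.sqrt_le_sqrt ?_))
    · linarith [hanti i h1, h.nonneg _ (hmem (j + 1) (by omega))]
    · linarith [hanti i h1, h.nonneg _ (hmem j (by omega))]
  refine tendsto_atTop_mono hlow (Tendsto.const_mul_atTop (by positivity)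
    (Tendsto.atTop_div_const (by positivity) ?_))
  exact (tendsto_rpow_atTop (by norm_num)).comp hφ

/-- On bounded sets of masses only finitely many affine costs compete. -/
theorem IsStepData.exists_forall_affineCost_lt (h : IsStepData N a φ)
    (hexh : N = ⊤ → Tendsto φ atTop atTop) (R : ℝ) :
    ∃ J ∈ pieceIndices N, ∀ w ≤ R, ∀ j ∈ pieceIndices N, J < j →
      affineCost a φ J w < affineCost a φ j w := by
  induction N with
  | coe n =>
    refine ⟨n, ⟨by exact_mod_cast h.nonempty, le_rfl⟩, fun w _ j hj hlt ↦ ?_⟩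
    exact absurd (Nat.cast_le.1 hj.2) (not_le.2 hlt)
  | top =>
    obtain ⟨J, hJ⟩ := eventually_atTop.1
      ((h.tendsto_crossingMass (hexh rfl)).eventually_gt_atTop R)
    refine ⟨max J 1, ⟨le_max_right _ _, le_top⟩, fun w hw j _ hlt ↦ ?_⟩
    have hstep : ∀ i, max J 1 ≤ i → affineCost a φ i w < affineCost a φ (i + 1) w := fun i hi ↦
      h.affineCost_lt_succ ((le_max_right _ _).trans hi) (ENat.natCast_lt_top i)
        (hw.trans_lt (hJ i ((le_max_left _ _).trans hi)))
    induction j, hlt using Nat.le_induction with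
    | base => exact hstep _ le_rfl
    | succ j hj ih => exact (ih ⟨by omega, le_top⟩).trans (hstep j (by omega))

theorem IsStepData.isPiecewiseAffine (h : IsStepData N a φ)
    (hexh : N = ⊤ → Tendsto φ atTop atTop) {τ : ℝ → ℝ}
    (hτ : ∀ w : ℝ, 0 ≤ w → IsGLB {t | ∃ j ∈ pieceIndices N, t = affineCost a φ j w} (τ w)) :
    IsPiecewiseAffine τ := by
  refine ⟨{x | ∃ i ∈ pieceIndices N, ∃ j ∈ pieceIndices N, i < j ∧
    affineCost a φ i x = affineCost a φ j x ∧
    ∀ k ∈ pieceIndices N, affineCost a φ i x ≤ affineCost a φ k x}, fun R ↦ ?_, ?_⟩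
  · obtain ⟨J, hJ, hJlt⟩ := h.exists_forall_affineCost_lt hexh R
    refine Set.Finite.subset (s := ⋃ i ∈ Finset.Icc 1 J, ⋃ j ∈ Finset.Icc 1 J,
      {x | i < j ∧ affineCost a φ i x = affineCost a φ j x}) ?_ ?_
    · refine Set.Finite.biUnion (Finset.finite_toSet _) fun i hi ↦
        Set.Finite.biUnion (Finset.finite_toSet _) fun j hj ↦ Set.Subsingleton.finite ?_
      simp only [Finset.coe_Icc, mem_Icc] at hi hj
      rintro x ⟨hij, hx⟩ y ⟨-, hy⟩
      have hlt := h.lt hi.1 hij (mem_pieceIndices_of_lt hj.1 hj.2 hJ)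
      simp only [affineCost] at hx hy
      have h0 : (x - y) * (a i - a j) = 0 := by linear_combination hx - hy
      rcases mul_eq_zero.1 h0 with h0 | h0 <;> linarith
    · rintro x ⟨⟨i, hi, j, hj, hij, hx, hmin⟩, hx0, hxR⟩
      have hjJ : j ≤ J := not_lt.1 fun hlt ↦
        absurd (hJlt x hxR j hj hlt) (not_lt.2 (hx ▸ hmin J hJ))
      simp only [mem_iUnion, Finset.mem_Icc]
      exact ⟨i, ⟨hi.1, by omega⟩, j, ⟨hj.1, hjJ⟩, hij, hx⟩
  · intro x y hx hxy hdisj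
    rcases hxy.eq_or_lt with rfl | hxy
    · exact ⟨0, τ x, fun t ht ↦ by rw [le_antisymm ht.2 ht.1]; ring⟩
    obtain ⟨J, hJ, hJlt⟩ := h.exists_forall_affineCost_lt hexh y
    have hmem : ∀ i ∈ Finset.Icc 1 J, i ∈ pieceIndices N := fun i hi ↦
      mem_pieceIndices_of_lt (Finset.mem_Icc.1 hi).1 (Finset.mem_Icc.1 hi).2 hJ
    have hall : ∀ t ≤ y, ∀ i, (∀ k ∈ Finset.Icc 1 J, affineCost a φ i t ≤ affineCost a φ k t) →
        ∀ k ∈ pieceIndices N, affineCost a φ i t ≤ affineCost a φ k t := by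
      intro t ht i hi k hk
      rcases le_or_gt k J with hkJ | hkJ
      · exact hi k (Finset.mem_Icc.2 ⟨hk.1, hkJ⟩)
      · exact (hi J (Finset.mem_Icc.2 ⟨hJ.1, le_rfl⟩)).trans (hJlt t ht k hk hkJ).le
    obtain ⟨j, hj, hjmin⟩ := exists_forall_le_of_no_ties (ℓ := affineCost a φ)
      (continuous_affineCost a φ) (F := Finset.Icc 1 J) ⟨1, Finset.mem_Icc.2 ⟨le_rfl, hJ.1⟩⟩ hxy
      (fun t ht i hi j hj hij h1 h2 ↦ by
        have heq := le_antisymm (h1 j hj) (h2 i hi)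
        rcases lt_or_gt_of_ne hij with hlt | hlt
        · exact Set.disjoint_left.1 hdisj ht
            ⟨i, hmem i hi, j, hmem j hj, hlt, heq, hall t ht.2.le i h1⟩
        · exact Set.disjoint_left.1 hdisj ht
            ⟨j, hmem j hj, i, hmem i hi, hlt, heq.symm, hall t ht.2.le j h2⟩)
    refine ⟨a j, affineCost a φ j 0, fun t ht ↦ ?_⟩
    have hleast : IsLeast {s | ∃ j ∈ pieceIndices N, s = affineCost a φ j t}
        (affineCost a φ j t) := by
      refine ⟨⟨j, hmem j hj, rfl⟩, ?_⟩
      rintro _ ⟨k, hk, rfl⟩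
      exact hall t ht.2 j (hjmin t ht) k hk
    rw [(hτ t (hx.trans ht.1)).unique hleast.isGLB]
    simp only [affineCost]
    ring

end StepData

/-! ### Decomposition of a piecewise affine cost into its affine pieces -/

/-- `τ` continues affinely with slope `m` from `x` up to `y`. -/
def AffineBetween (τ : ℝ → ℝ) (m x y : ℝ) : Prop := ∀ t ∈ Icc x y, τ t = τ x + m * (t - x)

theorem IsPiecewiseAffine.exists_right_slope {τ : ℝ → ℝ} (h : IsPiecewiseAffine τ) {x : ℝ}
    (hx : 0 ≤ x) : ∃ m δ, 0 < δ ∧ AffineBetween τ m x (x + δ) := by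
  obtain ⟨S, hS, haff⟩ := h
  have hfin : ((S ∩ Icc 0 (x + 1)) \ {x}).Finite := (hS (x + 1)).sdiff
  obtain ⟨ε, hε, hball⟩ := Metric.mem_nhds_iff.1 (hfin.isClosed.compl_mem_nhds (x := x) (by simp))
  obtain ⟨m, b, hmb⟩ := haff x (x + min ε 1) hx (by simp [hε.le]) (by
    refine Set.disjoint_left.2 fun t ht htS ↦ hball (a := t) ?_ ⟨⟨htS, ?_, ?_⟩, ?_⟩
    · rw [Metric.mem_ball, Real.dist_eq, abs_of_pos (by linarith [ht.1])]
      linarith [ht.2, min_le_left ε 1]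
    · linarith [ht.1]
    · linarith [ht.2, min_le_right ε 1]
    · exact ht.1.ne')
  refine ⟨m, min ε 1, by positivity, fun t ht ↦ ?_⟩
  rw [hmb t ht, hmb x ⟨le_rfl, by simp [hε.le]⟩]
  ring

/-- Every point is followed by a maximal interval of affinity, at whose end, if there is one, the
slope drops. -/
theorem IsAdmissible.exists_next_breakpoint {τ m δ : ℝ → ℝ} (h : IsAdmissible τ)
    (hδ : ∀ x, 0 ≤ x → 0 < δ x) (hm : ∀ x, 0 ≤ x → AffineBetween τ (m x) x (x + δ x)) {x : ℝ}
    (hx : 0 ≤ x) :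
    ∃ y, x < y ∧ AffineBetween τ (m x) x y ∧ ((∀ z, AffineBetween τ (m x) x z) ∨ m y < m x) := by
  by_cases hlast : ∀ z, AffineBetween τ (m x) x z
  · exact ⟨x + 1, by linarith, hlast _, Or.inl hlast⟩
  push Not at hlast
  obtain ⟨z, hz⟩ := hlast
  set E := {y | x ≤ y ∧ AffineBetween τ (m x) x y} with hE
  have hbdd : ∀ y ∈ E, y ≤ z := fun y hy ↦ not_lt.1 fun hlt ↦
    hz fun t ht ↦ hy.2 t ⟨ht.1, ht.2.trans hlt.le⟩
  have hmemE : x + δ x ∈ E := ⟨by linarith [hδ x hx], hm x hx⟩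
  have hlub := isLUB_csSup ⟨_, hmemE⟩ ⟨z, hbdd⟩
  set y := sSup E with hy
  have hxy : x < y := lt_of_lt_of_le (by linarith [hδ x hx]) (hlub.1 hmemE)
  have hy0 : 0 ≤ y := hx.trans hxy.le
  have hIco : EqOn τ (fun t ↦ τ x + m x * (t - x)) (Ico x y) := by
    intro t ht
    obtain ⟨y', hy', hlt⟩ := (lt_isLUB_iff hlub).1 ht.2
    exact hy'.2 t ⟨ht.1, hlt.le⟩
  have haff : AffineBetween τ (m x) x y := by
    refine hIco.of_subset_closure (h.continuous.mono fun t ht ↦ hx.trans ht.1)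
      (by fun_prop) Ico_subset_Icc_self ?_
    rw [closure_Ico hxy.ne]
  refine ⟨y, hxy, haff, Or.inr (lt_of_le_of_ne ?_ fun heq ↦ ?_)⟩
  · have h1 := h.concave.slope_anti_adjacent (x := x) (y := y) (z := y + δ y) hx
      (show 0 ≤ y + δ y by linarith [hδ y hy0]) hxy (by linarith [hδ y hy0])
    rw [haff y ⟨hxy.le, le_rfl⟩, hm y hy0 (y + δ y) ⟨by linarith [hδ y hy0], le_rfl⟩,
      haff y ⟨hxy.le, le_rfl⟩] at h1
    have h2 : 0 < y - x := sub_pos.2 hxy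
    have h3 := hδ y hy0
    rw [add_sub_cancel_left, add_sub_cancel_left, add_sub_cancel_left,
      mul_div_cancel_right₀ _ h3.ne', mul_div_cancel_right₀ _ h2.ne'] at h1
    exact h1
  · -- With equal slopes the interval of affinity would not be maximal.
    have : y + δ y ∈ E := by
      refine ⟨by linarith [hδ y hy0], fun t ht ↦ ?_⟩
      rcases le_total t y with hty | hty
      · exact haff t ⟨ht.1, hty⟩
      · rw [hm y hy0 t ⟨hty, ht.2⟩, haff y ⟨hxy.le, le_rfl⟩, heq]
        ring
    linarith [hlub.1 this, hδ y hy0]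

theorem exists_hasSlopes {τ : ℝ → ℝ} (h : IsAdmissible τ) (hpa : IsPiecewiseAffine τ) :
    ∃ (N : ℕ∞) (a w : ℕ → ℝ), HasSlopes N a w τ ∧ ∀ i, 0 ≤ a i := by
  classical
  choose! m δ hδ hm using fun x (hx : 0 ≤ x) ↦ hpa.exists_right_slope hx
  have hm0 : ∀ x, 0 ≤ x → 0 ≤ m x := by
    intro x hx
    have hd := hδ x hx
    have h1 := h.monotone (show x ∈ Ici 0 from hx) (show 0 ≤ x + δ x by linarith) (by linarith)
    rw [hm x hx (x + δ x) ⟨by linarith, le_rfl⟩, add_sub_cancel_left] at h1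
    exact nonneg_of_mul_nonneg_left (by linarith) hd
  choose! next hnext using fun x (hx : 0 ≤ x) ↦ h.exists_next_breakpoint hδ hm hx
  set w : ℕ → ℝ := fun n ↦ next^[n] 0 with hw
  have hw0 : w 0 = 0 := rfl
  have hwsucc : ∀ n, w (n + 1) = next (w n) := fun n ↦ Function.iterate_succ_apply' next n 0
  have hwnn : ∀ n, 0 ≤ w n := by
    intro n
    induction n with
    | zero => exact hw0.ge
    | succ n ih => rw [hwsucc]; exact ih.trans (hnext _ ih).1.le
  have hwlt : StrictMono w := strictMono_nat_of_lt_succ fun n ↦ by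
    rw [hwsucc]; exact (hnext _ (hwnn n)).1
  have haff : ∀ n, AffineBetween τ (m (w n)) (w n) (w (n + 1)) := fun n ↦ by
    rw [hwsucc]; exact (hnext _ (hwnn n)).2.1
  obtain ⟨N, hN1, hNlt, hNlast⟩ : ∃ N : ℕ∞, 1 ≤ N ∧
      (∀ n : ℕ, ((n + 1 : ℕ) : ℕ∞) < N → m (w (n + 1)) < m (w n)) ∧
      ∀ n : ℕ, ((n + 1 : ℕ) : ℕ∞) = N → ∀ z, AffineBetween τ (m (w n)) (w n) z := by
    have hdrop : ∀ n, ¬ (∀ z, AffineBetween τ (m (w n)) (w n) z) → m (w (n + 1)) < m (w n) :=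
      fun n hn ↦ by rw [hwsucc]; exact (hnext _ (hwnn n)).2.2.resolve_left hn
    by_cases hex : ∃ n, ∀ z, AffineBetween τ (m (w n)) (w n) z
    · refine ⟨((Nat.find hex + 1 : ℕ) : ℕ∞), by simp, fun n hn ↦ hdrop n (Nat.find_min hex ?_),
        fun n hn ↦ ?_⟩
      · have := Nat.cast_lt.1 hn
        omega
      · have : n = Nat.find hex := by
          have := Nat.cast_inj.1 hn
          omega
        exact this ▸ Nat.find_spec hex
    · push Not at hex
      exact ⟨⊤, le_top, fun n _ ↦ hdrop n (by push Not; exact hex n),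
        fun n hn ↦ absurd hn (ENat.natCast_ne_top _)⟩
  refine ⟨N, fun i ↦ m (w (i - 1)), w, ⟨hN1, ⟨hw0, hwlt.strictMonoOn _⟩, ?_, ?_, ?_⟩,
    fun i ↦ hm0 _ (hwnn _)⟩
  · rintro rfl
    refine (tendsto_atTop_of_monotone hwlt.monotone).resolve_right ?_
    rintro ⟨l, hl⟩
    have hwl : ∀ n, w n < l := fun n ↦
      (hwlt (Nat.lt_succ_self n)).trans_le (hwlt.monotone.ge_of_tendsto hl _)
    obtain ⟨S, hS, hSaff⟩ := hpa
    have hev : ∀ᶠ n in atTop, ∀ s ∈ (S ∩ Icc 0 l) \ {l}, s < w n := by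
      refine ((hS l).sdiff.eventually_all).2 fun s hs ↦ hl.eventually_const_lt ?_
      exact lt_of_le_of_ne hs.1.2.2 hs.2
    obtain ⟨n, hn⟩ := hev.exists
    obtain ⟨m', b, hmb⟩ := hSaff (w n) l (hwnn n) (hwl n).le (Set.disjoint_left.2 fun t ht htS ↦
      absurd (hn t ⟨⟨htS, (hwnn n).trans ht.1.le, ht.2.le⟩, ht.2.ne⟩) (not_lt.2 ht.1.le))
    -- Two consecutive slopes would both equal `m'`.
    have hslope : ∀ k, n ≤ k → m (w k) = m' := by
      intro k hk
      have h1 := haff k (w (k + 1)) ⟨(hwlt (Nat.lt_succ_self k)).le, le_rfl⟩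
      rw [hmb _ ⟨hwlt.monotone (by omega), (hwl _).le⟩, hmb _ ⟨hwlt.monotone hk, (hwl _).le⟩] at h1
      have h2 : 0 < w (k + 1) - w k := sub_pos.2 (hwlt (Nat.lt_succ_self k))
      exact mul_right_cancel₀ h2.ne' (by linarith)
    have := hNlt n (ENat.natCast_lt_top _)
    rw [hslope n le_rfl, hslope (n + 1) (by omega)] at this
    exact lt_irrefl _ this
  · intro i hi j hj hij
    have hstep : ∀ n, 1 ≤ n → n + 1 ∈ pieceIndices N → m (w (n + 1 - 1)) < m (w (n - 1)) := by
      intro n hn hnN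
      obtain ⟨k, rfl⟩ := Nat.exists_eq_add_of_le' hn
      exact hNlt k (succ_mem_pieceIndices.1 hnN)
    induction j, hij using Nat.le_induction with
    | base => exact hstep i hi.1 hj
    | succ j hij ih =>
      have hj' := mem_pieceIndices_of_lt (by omega : 1 ≤ j) (Nat.le_succ j) hj
      exact (hstep j hj'.1 hj).trans (ih hj')
  · intro i hi x hx
    obtain ⟨k, rfl⟩ := Nat.exists_eq_add_of_le' hi.1
    rcases hi.2.lt_or_eq with hlt | heq
    · exact haff k x ⟨hx.1, (hx.2 hlt).le⟩
    · exact hNlast k heq x x ⟨hx.1, le_rfl⟩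

/-! ### Recovering the phase field cost from the transport cost -/

/-- The solution `φ_j^{3/2} - φ_{j-1}^{3/2}` of the recursion determined by slopes `a` and
breakpoints `w`. -/
noncomputable def levelIncrement (a w : ℕ → ℝ) (j : ℕ) : ℝ :=
  (3 * w j / (4 * √2) - ∑ i ∈ (Finset.Ico 1 j).attach, levelIncrement a w i.1 /
    (√(a i.1 - a (j + 1)) + √(a i.1 - a j))) * √(a j - a (j + 1))
termination_by j
decreasing_by exact (Finset.mem_Ico.1 i.2).2

theorem levelIncrement_eq (a w : ℕ → ℝ) (j : ℕ) :
    levelIncrement a w j = (3 * w j / (4 * √2) - ∑ i ∈ Finset.Ico 1 j, levelIncrement a w i /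
      (√(a i - a (j + 1)) + √(a i - a j))) * √(a j - a (j + 1)) := by
  rw [levelIncrement, Finset.sum_attach (Finset.Ico 1 j) fun i ↦ levelIncrement a w i /
    (√(a i - a (j + 1)) + √(a i - a j))]

section Recursion

variable {N : ℕ∞} {a w : ℕ → ℝ} {τ : ℝ → ℝ}

theorem HasSlopes.lt (h : HasSlopes N a w τ) {i j : ℕ} (hi : 1 ≤ i) (hij : i < j)
    (hj : j ∈ pieceIndices N) : a j < a i :=
  h.strictAnti (mem_pieceIndices_of_lt hi hij.le hj) hj hij

/-- A family of increments solving the recursion at `j` turns it into a closed formula for `w_j`. -/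
theorem sum_div_eq_of_recursion {D : ℕ → ℝ} {x : ℝ} {j : ℕ} (hj : 1 ≤ j) (ha : a (j + 1) < a j)
    (hD : D j = (x - ∑ i ∈ Finset.Ico 1 j, D i / (√(a i - a (j + 1)) + √(a i - a j))) *
      √(a j - a (j + 1))) :
    ∑ i ∈ Finset.Ico 1 (j + 1), D i / (√(a i - a (j + 1)) + √(a i - a j)) = x := by
  have hs : √(a j - a (j + 1)) ≠ 0 := (Real.sqrt_pos.2 (sub_pos.2 ha)).ne'
  rw [Finset.sum_Ico_succ_top hj, sub_self, Real.sqrt_zero, add_zero]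
  nth_rewrite 1 [hD]
  rw [mul_div_cancel_right₀ _ hs]
  ring

/-- In passing from `j - 1` to `j` the denominators of the recursion grow, so the sum subtracted
from `3 w_j / (4√2)` is at most `3 w_{j-1} / (4√2)`. -/
theorem HasSlopes.levelIncrement_pos (h : HasSlopes N a w τ) {j : ℕ} (hj : 1 ≤ j)
    (hjN : (j : ℕ∞) < N) : 0 < levelIncrement a w j := by
  induction j using Nat.strong_induction_on with
  | _ j ih =>
  have hj1 := succ_mem_pieceIndices.2 hjN
  rw [levelIncrement_eq]
  refine mul_pos (sub_pos.2 ?_) (Real.sqrt_pos.2 (sub_pos.2 (h.lt hj (Nat.lt_succ_self j) hj1)))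
  rcases hj.eq_or_lt with rfl | hj2
  · simpa using h.partition.pos le_rfl hjN
  obtain ⟨k, rfl⟩ := Nat.exists_eq_add_of_le' hj
  have hk : 1 ≤ k := by omega
  have hlt : ∀ i, i ≤ k + 1 → (i : ℕ∞) < N := fun i hi ↦ natCast_lt_of_lt (by omega) hj1
  have hmem := mem_pieceIndices_of_lt hj (Nat.le_succ _) hj1
  have hrec := sum_div_eq_of_recursion hk (h.lt hk (Nat.lt_succ_self k) hmem)
    (levelIncrement_eq a w k)
  calc _ ≤ ∑ i ∈ Finset.Ico 1 (k + 1),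
        levelIncrement a w i / (√(a i - a (k + 1)) + √(a i - a k)) := by
        refine Finset.sum_le_sum fun i hi ↦ ?_
        obtain ⟨h1, h2⟩ := Finset.mem_Ico.1 hi
        have e1 := h.lt h1 h2 hmem
        have e2 := h.lt hj (Nat.lt_succ_self (k + 1)) hj1
        have e3 := h.lt hk (Nat.lt_succ_self k) hmem
        refine div_le_div_of_nonneg_left (ih i h2 h1 (hlt i (by omega))).le
          (add_pos_of_pos_of_nonneg (Real.sqrt_pos.2 (sub_pos.2 e1)) (Real.sqrt_nonneg _))
          (add_le_add (Real.sqrt_le_sqrt (by linarith)) (Real.sqrt_le_sqrt (by linarith)))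
    _ = 3 * w k / (4 * √2) := hrec
    _ < 3 * w (k + 1) / (4 * √2) := by
        have := h.partition.lt hj hjN
        rw [Nat.add_sub_cancel] at this
        gcongr

theorem HasSlopes.exists_recursion (h : HasSlopes N a w τ) (ha : ∀ i, 0 ≤ a i) :
    ∃ φ : ℕ → ℝ, IsStepData N a φ ∧ SatisfiesRecursion N a w φ := by
  set P : ℕ → ℝ := fun j ↦ ∑ i ∈ Finset.Ico 1 (j + 1), levelIncrement a w i with hP
  have hPnn : ∀ j : ℕ, (j : ℕ∞) < N → 0 ≤ P j := fun j hj ↦ Finset.sum_nonneg fun i hi ↦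
    (h.levelIncrement_pos (Finset.mem_Ico.1 hi).1
      ((Nat.cast_le.2 (by have := (Finset.mem_Ico.1 hi).2; omega)).trans_lt hj)).le
  have hPsub : ∀ j, 1 ≤ j → P j - P (j - 1) = levelIncrement a w j := by
    intro j hj
    simp only [hP]
    rw [Finset.sum_Ico_succ_top hj, Nat.sub_add_cancel hj]
    ring
  set φ : ℕ → ℝ := fun j ↦ P j ^ (2 / 3 : ℝ) with hφ
  have hpow : ∀ j : ℕ, (j : ℕ∞) < N → φ j ^ (3 / 2 : ℝ) = P j := fun j hj ↦ by
    rw [hφ, ← Real.rpow_mul (hPnn j hj)]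
    norm_num
  have hpred : ∀ j : ℕ, (j : ℕ∞) < N → ((j - 1 : ℕ) : ℕ∞) < N := fun j hj ↦
    (Nat.cast_le.2 (Nat.sub_le j 1)).trans_lt hj
  have hinc : ∀ j : ℕ, 1 ≤ j → (j : ℕ∞) < N →
      φ j ^ (3 / 2 : ℝ) - φ (j - 1) ^ (3 / 2 : ℝ) = levelIncrement a w j := fun j hj hjN ↦ by
    rw [hpow j hjN, hpow _ (hpred j hjN), hPsub j hj]
  refine ⟨φ, ⟨h.nonempty, ⟨by simp [hφ, hP, Real.zero_rpow], ?_⟩, h.strictAnti, fun i _ ↦ ha i⟩, ?_⟩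
  · intro i _ j (hj : (j : ℕ∞) < N) hij
    induction j, hij using Nat.le_induction with
    | base =>
      refine Real.rpow_lt_rpow (hPnn i (hpred _ hj)) ?_ (by norm_num)
      have := h.levelIncrement_pos (Nat.le_add_left 1 i) hj
      rw [← hPsub _ (Nat.le_add_left 1 i), Nat.add_sub_cancel] at this
      linarith
    | succ j hij ih =>
      refine (ih (hpred _ hj)).trans (Real.rpow_lt_rpow (hPnn j (hpred _ hj)) ?_ (by norm_num))
      have := h.levelIncrement_pos (Nat.le_add_left 1 j) hj
      rw [← hPsub _ (Nat.le_add_left 1 j), Nat.add_sub_cancel] at this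
      linarith
  · intro j hj hjN
    rw [hinc j hj hjN, levelIncrement_eq]
    congr 2
    refine Finset.sum_congr rfl fun i hi ↦ ?_
    obtain ⟨h1, h2⟩ := Finset.mem_Ico.1 hi
    rw [hinc i h1 ((Nat.cast_lt.2 h2).trans hjN)]

theorem SatisfiesRecursion.crossingMass_eq {φ : ℕ → ℝ} (hr : SatisfiesRecursion N a w φ)
    (h : HasSlopes N a w τ) {j : ℕ} (hj : 1 ≤ j) (hjN : (j : ℕ∞) < N) :
    crossingMass a φ j = w j := by
  rw [crossingMass, sum_div_eq_of_recursion
    (D := fun i ↦ φ i ^ (3 / 2 : ℝ) - φ (i - 1) ^ (3 / 2 : ℝ)) hj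
    (h.lt hj (Nat.lt_succ_self j) (succ_mem_pieceIndices.2 hjN)) (hr j hj hjN)]
  field_simp

/-- On each piece, `τ` is the affine cost of the same index, since the affine costs with indices
`j` and `j + 1` cross at `w_j`. -/
theorem HasSlopes.eq_affineCost {φ : ℕ → ℝ} (h : HasSlopes N a w τ) (hφ : IsStepData N a φ)
    (hr : SatisfiesRecursion N a w φ) (hτ : IsAdmissible τ) {j : ℕ} (hj : j ∈ pieceIndices N)
    {x : ℝ} (hx : x ∈ piece N w j) : τ x = affineCost a φ j x := by
  have hleft : τ (w (j - 1)) = affineCost a φ j (w (j - 1)) := by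
    obtain ⟨hj1, hjN⟩ := hj
    clear hx
    induction j, hj1 using Nat.le_induction with
    | base => simp [h.partition.zero, hτ.zero, affineCost]
    | succ j hj1 ih =>
      have hlt : (j : ℕ∞) < N := succ_mem_pieceIndices.1 ⟨by omega, hjN⟩
      have hwlt := h.partition.lt hj1 hlt
      have hIco : EqOn τ (fun t ↦ τ (w (j - 1)) + a j * (t - w (j - 1))) (Ico (w (j - 1)) (w j)) :=
        fun t ht ↦ h.affine j ⟨hj1, hlt.le⟩ t ⟨ht.1, fun _ ↦ ht.2⟩
      have h0 : 0 ≤ w (j - 1) :=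
        h.partition.nonneg ((Nat.cast_le.2 (Nat.sub_le j 1)).trans_lt hlt)
      have hIcc := hIco.of_subset_closure (hτ.continuous.mono fun t ht ↦ h0.trans ht.1)
        (by fun_prop) Ico_subset_Icc_self (by rw [closure_Ico hwlt.ne])
      have hend := hIcc ⟨hwlt.le, le_rfl⟩
      have hcross := hφ.affineCost_succ_sub hj1 hlt (w j)
      rw [hr.crossingMass_eq h hj1 hlt, sub_self, mul_zero] at hcross
      rw [Nat.add_sub_cancel, sub_eq_zero.1 hcross]
      simp only [ih hlt.le] at hend
      rw [hend]
      simp only [affineCost]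
      ring
  rw [h.affine j hj x hx, hleft]
  simp only [affineCost]
  ring

theorem HasSlopes.isGLB {φ : ℕ → ℝ} (h : HasSlopes N a w τ) (hφ : IsStepData N a φ)
    (hr : SatisfiesRecursion N a w φ) (hτ : IsAdmissible τ) {x : ℝ} (hx : 0 ≤ x) :
    IsGLB {t | ∃ j ∈ pieceIndices N, t = affineCost a φ j x} (τ x) := by
  obtain ⟨j, hj, hxj⟩ : ∃ j ∈ pieceIndices N, x ∈ piece N w j := by
    refine (h.partition.exists_mem_piece h.nonempty hx).resolve_right ?_
    rintro ⟨hN, hall⟩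
    obtain ⟨i, hi⟩ := ((h.exhaust hN).eventually_gt_atTop x).exists
    exact absurd (hall i) (not_le.2 hi)
  rw [h.eq_affineCost hφ hr hτ hj hxj]
  have hstep : ∀ i : ℕ, 1 ≤ i → (i : ℕ∞) < N → affineCost a φ (i + 1) x - affineCost a φ i x =
      (a i - a (i + 1)) * (w i - x) := fun i hi hiN ↦ by
    rw [hφ.affineCost_succ_sub hi hiN, hr.crossingMass_eq h hi hiN]
  have hpos : ∀ i : ℕ, 1 ≤ i → (i : ℕ∞) < N → 0 ≤ a i - a (i + 1) := fun i hi hiN ↦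
    sub_nonneg.2 (h.lt hi (Nat.lt_succ_self i) (succ_mem_pieceIndices.2 hiN)).le
  refine IsLeast.isGLB ⟨⟨j, hj, rfl⟩, ?_⟩
  rintro _ ⟨i, hi, rfl⟩
  rcases le_total j i with hij | hij
  · -- Beyond `j` the affine costs increase at `x`, which lies to the left of their crossings.
    induction i, hij using Nat.le_induction with
    | base => exact le_rfl
    | succ i hij ih =>
      have hiN := succ_mem_pieceIndices.1 hi
      have hi1 : 1 ≤ i := hj.1.trans hij
      refine (ih ⟨hi1, hiN.le⟩).trans (sub_nonneg.1 ?_)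
      rw [hstep i hi1 hiN]
      exact mul_nonneg (hpos i hi1 hiN) (sub_nonneg.2 ((hxj.2 ((Nat.cast_le.2 hij).trans_lt
        hiN)).le.trans (h.partition.mono hij hiN)))
  · -- Below `j` they decrease, since `x` lies to the right of their crossings.
    refine Nat.decreasingInduction' (P := fun k ↦ affineCost a φ j x ≤ affineCost a φ k x)
      (fun k hk hik ih ↦ ih.trans (sub_nonpos.1 ?_)) hij le_rfl
    have hkN := natCast_lt_of_lt hk hj
    rw [hstep k (hi.1.trans hik) hkN]
    refine mul_nonpos_of_nonneg_of_nonpos (hpos k (hi.1.trans hik) hkN) (sub_nonpos.2 ?_)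
    exact (h.partition.mono (Nat.le_sub_one_of_lt hk)
      (natCast_lt_of_lt (by omega : j - 1 < j) hj)).trans hxj.1

end Recursion

theorem IsPartition.piece_index_unique {N : ℕ∞} {p : ℕ → ℝ} (h : IsPartition N p) {i j : ℕ}
    (hi : i ∈ pieceIndices N) (hj : j ∈ pieceIndices N) {x : ℝ} (hxi : x ∈ piece N p i)
    (hxj : x ∈ piece N p j) : i = j := by
  have aux : ∀ i j, j ∈ pieceIndices N → x ∈ piece N p i → x ∈ piece N p j → ¬ i < j := by
    intro i j hj hxi hxj hij
    have := h.mono (Nat.le_sub_one_of_lt hij)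
      (natCast_lt_of_lt (by have := hj.1; omega : j - 1 < j) hj)
    linarith [hxi.2 (natCast_lt_of_lt hij hj), hxj.1]
  exact le_antisymm (not_lt.1 (aux j i hi hxj hxi)) (not_lt.1 (aux i j hj hxi hxj))

theorem IsStepData.exists_isStepCost {N : ℕ∞} {a φ : ℕ → ℝ} (h : IsStepData N a φ) :
    ∃ c, IsStepCost N a φ c := by
  classical
  refine ⟨fun x ↦ x * if hx : ∃ i ∈ pieceIndices N, x ∈ piece N φ i then a hx.choose else
    ⨅ i : ℕ, a (i + 1), zero_mul _, fun i hi x hxi hx0 ↦ ?_, ?_⟩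
  · have hx : ∃ i ∈ pieceIndices N, x ∈ piece N φ i := ⟨i, hi, hxi⟩
    simp only [massSpecificCost]
    rw [dif_pos hx, mul_div_cancel_left₀ _ hx0.ne',
      h.partition.piece_index_unique hx.choose_spec.1 hi hx.choose_spec.2 hxi]
  · rintro rfl x hall
    have hx : ¬ ∃ i ∈ pieceIndices ⊤, x ∈ piece ⊤ φ i := by
      rintro ⟨i, -, hxi⟩
      exact absurd (hall i) (not_le.2 (hxi.2 (ENat.natCast_lt_top i)))
    have hx0 : 0 < x := (h.partition.pos le_rfl (ENat.natCast_lt_top 1)).trans_le (hall 1)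
    simp only [massSpecificCost]
    rw [dif_neg hx, mul_div_cancel_left₀ _ hx0.ne']

theorem mainTheorem2 :
    (∀ (N : ℕ∞) (a φ : ℕ → ℝ) (c : ℝ → ℝ), IsStepData N a φ → IsStepCost N a φ c →
      ∃ τ : ℝ → ℝ, Induces c τ ∧
        (∀ w : ℝ, 0 ≤ w → IsGLB {t | ∃ j ∈ pieceIndices N, t = affineCost a φ j w} (τ w)) ∧
        ((N = ⊤ → Tendsto φ atTop atTop) → IsPiecewiseAffine τ)) ∧
    (∀ τ : ℝ → ℝ, IsAdmissible τ → IsPiecewiseAffine τ →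
      ∃ (N : ℕ∞) (a w : ℕ → ℝ), HasSlopes N a w τ ∧
        ∃ (φ : ℕ → ℝ) (c : ℝ → ℝ), IsStepData N a φ ∧ SatisfiesRecursion N a w φ ∧
          IsStepCost N a φ c ∧ Induces c τ) := by
  refine ⟨fun N a φ c h hc ↦ ?_, fun τ hτ hpa ↦ ?_⟩
  · have hglb := fun w (hw : 0 ≤ w) ↦ h.isGLB_sInf hw
    exact ⟨_, hc.induces h hglb, hglb, fun hexh ↦ h.isPiecewiseAffine hexh hglb⟩
  · obtain ⟨N, a, w, hs, ha⟩ := exists_hasSlopes hτ hpa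
    obtain ⟨φ, h, hr⟩ := hs.exists_recursion ha
    obtain ⟨c, hc⟩ := h.exists_isStepCost
    exact ⟨N, a, w, hs, φ, c, h, hr, hc, hc.induces h fun x hx ↦ hs.isGLB h hr hτ hx⟩
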